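/- Let $K\subset\mathbb{C}$ be a CM-field, finite and Galois over $\mathbb{Q}$, let $G=\mathrm{Gal}(K/\mathbb{Q})$, and let $\iota\in G$ be complex conjugation. A complex abelian variety $A$ is called CM if $\mathrm{End}^0(A)=\mathrm{End}(A)\otimes\mathbb{Q}$ contains an étale $\mathbb{Q}$-subalgebra of degree $2\dim A$, and it is said to be split by $K$ if $\mathrm{End}^0(A)\otimes_{\mathbb{Q}}K$ is isomorphic to a product of matrix algebras over $K$. Let $S$ be a finite left $G$-set on which $\iota$ acts without fixed points, let $S^+\subset S$ be a subset with $S=S^+\sqcup\iota S^+$, and let $E=\mathrm{Hom}(S,K)^G$ be the $\mathbb{Q}$-algebra of $G$-equivariant maps $S\to K$. The variety $A(S,S^+)$ defined by the pair $(S,S^+)$ is the quotient of $\mathbb{C}^{S^+}$ by the image of a lattice $\Lambda$ in $E$ (a finitely generated subgroup spanning $E$ over $\mathbb{Q}$) under $e\mapsto(e(s))_{s\in S^+}$. Proposition. A CM-type on $K$ is a subset $\Phi$ of $G$ such that $G=\Phi\sqcup\iota\Phi$. Let $G$ act on the set $S$ of CM-types on $K$ by the rule $g\Phi=\Phi\circ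 g^{-1}=\{\varphi\circ g^{-1}\mid\varphi\in\Phi\}$, and let $S^+$ be the set of CM-types on $K$ containing $1_G$. Then $S$ is a finite left $G$-set on which $\iota$ acts without fixed points and $S=S^+\sqcup\iota S^+$; lattices $\Lambda$ in $E$ exist; for every such $\Lambda$ the quotient $A(S,S^+)$ is a complex abelian variety that is CM and split by $K$; and different choices of $\Lambda$ give isogenous varieties. Moreover, every simple CM complex abelian variety $B$ split by $K$ is an isogeny factor of $A(S,S^+)$, i.e. $A(S,S^+)$ is isogenous to $B\times C$ for some abelian variety $C$. -/

import Mathlib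

open scoped Topology TensorProduct

universe u v w

noncomputable section

/-! ## Abelian varieties over `ℂ`

A complex torus is written as `V ⧸ Λ`, where `V` is a finite dimensional complex vector space
and `Λ` a lattice in `V`. A complex abelian variety is a complex torus that has a polarization
(a Riemann form). -/

namespace ComplexTorus

section Morphisms

variable {V : Type u} [NormedAddCommGroup V] [NormedSpace ℂ V]
variable {W : Type v} [NormedAddCommGroup W] [NormedSpace ℂ W]
variable {U : Type w} [NormedAddCommGroup U] [NormedSpace ℂ U]

/-- `V ⧸ Λ` is an abelian variety: `Λ` is a discrete subgroup spanning `V` over `ℝ`, and there is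
a Riemann form, i.e. an alternating `ℝ`-bilinear form `ψ` on `V`, integral on `Λ`, with
`ψ (iu, iv) = ψ (u, v)` and `ψ (iu, u) > 0` for `u ≠ 0`. -/
structure IsAbelianVariety [FiniteDimensional ℂ V] (Λ : Submodule ℤ V) : Prop where
  discrete : DiscreteTopology Λ
  span_eq_top : Submodule.span ℝ (Λ : Set V) = ⊤
  polarizable : ∃ ψ : V →ₗ[ℝ] V →ₗ[ℝ] ℝ,
    (∀ u, ψ u u = 0) ∧
    (∀ u ∈ Λ, ∀ v ∈ Λ, ∃ n : ℤ, ψ u v = n) ∧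
    (∀ u v, ψ (Complex.I • u) (Complex.I • v) = ψ u v) ∧
    (∀ u, u ≠ 0 → 0 < ψ (Complex.I • u) u)

/-- A homomorphism of tori is holomorphic if it lifts, locally on the universal covering, to a
holomorphic map. -/
def IsHolomorphic {Λ : Submodule ℤ V} {M : Submodule ℤ W} (f : V ⧸ Λ →+ W ⧸ M) : Prop :=
  ∀ x : V, ∃ F : V → W, ∀ᶠ y in 𝓝 x,
    DifferentiableAt ℂ F y ∧ f (Submodule.Quotient.mk y) = Submodule.Quotient.mk (F y)

theorem IsHolomorphic.comp {Λ : Submodule ℤ V} {M : Submodule ℤ W} {N : Submodule ℤ U}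
    {g : W ⧸ M →+ U ⧸ N} {f : V ⧸ Λ →+ W ⧸ M} (hg : IsHolomorphic g) (hf : IsHolomorphic f) :
    IsHolomorphic (g.comp f) := by
  intro x
  obtain ⟨F, hF⟩ := hf x
  obtain ⟨H, hH⟩ := hg (F x)
  refine ⟨H ∘ F, ?_⟩
  have hc : ContinuousAt F x := hF.self_of_nhds.1.continuousAt
  filter_upwards [hF, hc.eventually hH] with y h1 h2
  refine ⟨h2.1.comp y h1.1, ?_⟩
  simp [h1.2, h2.2]

/-- The ring `End(A)` of holomorphic endomorphisms of the torus `A = V ⧸ Λ`. -/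
def End (Λ : Submodule ℤ V) : Subring (AddMonoid.End (V ⧸ Λ)) where
  carrier := {f | IsHolomorphic (Λ := Λ) (M := Λ) f}
  mul_mem' := fun ha hb => IsHolomorphic.comp ha hb
  one_mem' := fun _ => ⟨id, Filter.Eventually.of_forall fun _ => ⟨differentiableAt_id, rfl⟩⟩
  add_mem' := by
    intro a b ha hb x
    obtain ⟨F, hF⟩ := ha x
    obtain ⟨H, hH⟩ := hb x
    refine ⟨F + H, ?_⟩
    filter_upwards [hF, hH] with y h1 h2
    refine ⟨h1.1.add h2.1, ?_⟩
    exact congrArg₂ (fun p q : V ⧸ Λ => p + q) h1.2 h2.2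
  zero_mem' := fun _ =>
    ⟨fun _ => 0, Filter.Eventually.of_forall fun _ => ⟨differentiableAt_const _, rfl⟩⟩
  neg_mem' := by
    intro a ha x
    obtain ⟨F, hF⟩ := ha x
    refine ⟨-F, ?_⟩
    filter_upwards [hF] with y h1
    refine ⟨h1.1.neg, ?_⟩
    exact congrArg (fun p : V ⧸ Λ => -p) h1.2

/-- `End⁰(A) = End(A) ⊗ ℚ`, a `ℚ`-algebra. -/
abbrev EndZero (Λ : Submodule ℤ V) : Type u := ℚ ⊗[ℤ] (End Λ)

/-- `V ⧸ Λ` is isogenous to `W ⧸ M`: there is a surjective holomorphic homomorphism with finite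
kernel. -/
def Isogenous (Λ : Submodule ℤ V) (M : Submodule ℤ W) : Prop :=
  ∃ f : V ⧸ Λ →+ W ⧸ M, IsHolomorphic f ∧ Function.Surjective f ∧ Finite f.ker

/-- `V ⧸ Λ` is simple: it is nonzero, and its only abelian subvarieties are `0` and itself. The
abelian subvarieties are the `W / (W ∩ Λ)` with `W` a complex subspace of `V` in which `W ∩ Λ` is
a lattice (discreteness of `W ∩ Λ` and a polarization are inherited from `V ⧸ Λ`). -/
def IsSimple (Λ : Submodule ℤ V) : Prop :=
  Nontrivial V ∧ ∀ W : Submodule ℂ V,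
    Submodule.span ℝ ((W : Set V) ∩ (Λ : Set V)) = W.restrictScalars ℝ → W = ⊥ ∨ W = ⊤

/-- `W ⧸ M` is an isogeny factor of `V ⧸ Λ`: for some abelian variety `U ⧸ N`, the torus `V ⧸ Λ` is
isogenous to the product `(W × U) ⧸ (M × N)` of `W ⧸ M` and `U ⧸ N`. -/
def IsIsogenyFactor (M : Submodule ℤ W) (Λ : Submodule ℤ V) : Prop :=
  ∃ (U : Type u) (_ : NormedAddCommGroup U) (_ : NormedSpace ℂ U) (_ : FiniteDimensional ℂ U)
    (N : Submodule ℤ U), IsAbelianVariety N ∧ Isogenous Λ (M.prod N)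

/-- `A = V ⧸ Λ` is CM, i.e. has sufficiently many endomorphisms: `End⁰(A)` contains an étale
`ℚ`-subalgebra of degree `2 dim A`. -/
def IsCM (Λ : Submodule ℤ V) : Prop :=
  ∃ (E : Type u) (_ : CommRing E) (_ : Algebra ℚ E) (i : E →ₐ[ℚ] EndZero Λ),
    Algebra.Etale ℚ E ∧ Function.Injective i ∧
      Module.finrank ℚ E = 2 * Module.finrank ℂ V

/-- `A = V ⧸ Λ` is split by the field `K`: `End⁰(A) ⊗ K` is isomorphic to a finite product of
matrix algebras over `K`. -/
def IsSplitBy (K : Type*) [Field K] [CharZero K] (Λ : Submodule ℤ V) : Prop :=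
  ∃ (n : ℕ) (d : Fin n → ℕ),
    Nonempty (K ⊗[ℚ] EndZero Λ ≃ₐ[K] ((j : Fin n) → Matrix (Fin (d j)) (Fin (d j)) K))

end Morphisms

end ComplexTorus

/-! ## Pairs `(S, S⁺)` and the tori they define -/

section Pairs

/-- Complex conjugation on a CM-field `K`, as an element of `Gal(K/ℚ)`. -/
def conjGal (K : Type*) [Field K] [NumberField K] [NumberField.IsCMField K] : Gal(K/ℚ) :=
  (NumberField.IsCMField.complexConj K).restrictScalars ℚ

theorem apply_conjGal {K : Type*} [Field K] [NumberField K] [NumberField.IsCMField K]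
    (φ : K →+* ℂ) (x : K) : φ (conjGal K x) = (starRingEnd ℂ) (φ x) :=
  NumberField.IsCMField.complexEmbedding_complexConj K φ x

theorem mul_conjGal {K : Type*} [Field K] [NumberField K] [NumberField.IsCMField K]
    (g : Gal(K/ℚ)) : g * conjGal K = conjGal K * g := by
  ext x
  let φ : K →+* ℂ := Classical.choice inferInstance
  apply φ.injective
  have h := apply_conjGal (φ.comp (g : K →+* K)) x
  simp only [AlgEquiv.mul_apply]
  rw [apply_conjGal]
  exact h

/-- The `ℚ`-algebra `E = Hom(S, K)^G` of `G`-equivariant maps `S → K`, where `G = Gal(K/ℚ)`. -/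
def equivariantMaps (K : Subfield ℂ) (S : Type*) [MulAction Gal(K/ℚ) S] : Subalgebra ℚ (S → K) where
  carrier := {f | ∀ (g : Gal(K/ℚ)) (s : S), f (g • s) = g (f s)}
  mul_mem' := fun ha hb g s => by simp [ha g s, hb g s]
  add_mem' := fun ha hb g s => by simp [ha g s, hb g s]
  algebraMap_mem' := fun r g s => by simp

variable (K : Subfield ℂ) [NumberField K] [NumberField.IsCMField K]

/-- `S` is a finite left `Gal(K/ℚ)`-set on which `ι` acts without fixed points, and
`S = S⁺ ⊔ ι S⁺`. -/
structure IsCMPair (S : Type*) [MulAction Gal(K/ℚ) S] (Sp : Set S) : Prop where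
  finite : Finite S
  conj_smul_ne : ∀ s : S, conjGal K • s ≠ s
  disjoint : Disjoint Sp ((fun s => conjGal K • s) '' Sp)
  union_eq : Sp ∪ (fun s => conjGal K • s) '' Sp = Set.univ

/-- A lattice in `E = Hom(S, K)^G`: a finitely generated subgroup spanning `E` over `ℚ`. -/
def IsLattice (S : Type*) [MulAction Gal(K/ℚ) S] (Λ : Submodule ℤ (equivariantMaps K S)) : Prop :=
  Λ.FG ∧ Submodule.span ℚ (Λ : Set (equivariantMaps K S)) = ⊤

/-- The map `E → ℂ^{S⁺}`, `e ↦ (e(s))_s`: the embedding defined by `S⁺`, each `s : S` being regarded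
as the homomorphism `e ↦ e(s)` from `E` into `K ⊆ ℂ`. -/
def evalAt (S : Type*) [MulAction Gal(K/ℚ) S] (Sp : Set S) :
    equivariantMaps K S →ₗ[ℤ] (Sp → ℂ) where
  toFun e s := ((e : S → K) s : ℂ)
  map_add' a b := by ext; simp
  map_smul' n a := by ext; simp

/-- The image in `ℂ^{S⁺}` of a lattice `Λ` of `E`. The torus `A(S, S⁺)` is the quotient
`ℂ^{S⁺} ⧸ periods K S S⁺ Λ`. -/
def periods (S : Type*) [MulAction Gal(K/ℚ) S] (Sp : Set S)
    (Λ : Submodule ℤ (equivariantMaps K S)) : Submodule ℤ (Sp → ℂ) :=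
  Λ.map (evalAt K S Sp)

/-! ## CM-types on `K` -/

/-- A CM-type on `K`: a subset `Φ` of `G = Gal(K/ℚ)` such that `G = Φ ⊔ ιΦ`. (As `K ⊆ ℂ` is Galois
over `ℚ`, the embeddings of `K` in `ℂ` are the elements of `G`.) -/
def CMType : Type :=
  {Φ : Set Gal(K/ℚ) // Disjoint Φ ((fun φ => conjGal K * φ) '' Φ) ∧
    Φ ∪ (fun φ => conjGal K * φ) '' Φ = Set.univ}

instance : Finite (CMType K) := inferInstanceAs (Finite (Subtype _))

/-- The action `g Φ = Φ ∘ g⁻¹ = {φ ∘ g⁻¹ | φ ∈ Φ}` of `G` on the set of CM-types. -/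
instance : MulAction Gal(K/ℚ) (CMType K) where
  smul g Φ := ⟨(fun φ => φ * g⁻¹) '' Φ.1, by
    have h : (fun φ => conjGal K * φ) '' ((fun φ => φ * g⁻¹) '' Φ.1) =
        (fun φ => φ * g⁻¹) '' ((fun φ => conjGal K * φ) '' Φ.1) := by
      simp only [Set.image_image, mul_assoc]
    rw [h]
    refine ⟨?_, ?_⟩
    · exact (Set.disjoint_image_iff (mul_left_injective g⁻¹)).2 Φ.2.1
    · rw [← Set.image_union, Φ.2.2, Set.image_univ]
      exact (Group.mulRight_bijective g⁻¹).surjective.range_eq⟩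
  one_smul Φ := Subtype.ext (by
    change (fun φ => φ * (1 : Gal(K/ℚ))⁻¹) '' Φ.1 = Φ.1
    simp)
  mul_smul g h Φ := Subtype.ext (by
    change (fun φ => φ * (g * h)⁻¹) '' Φ.1 = (fun φ => φ * g⁻¹) '' ((fun φ => φ * h⁻¹) '' Φ.1)
    simp only [Set.image_image, mul_inv_rev, mul_assoc])

/-- The set `S⁺` of CM-types on `K` containing `1_G`. -/
def CMType.plus : Set (CMType K) := {Φ | (1 : Gal(K/ℚ)) ∈ Φ.1}

instance : Fintype (CMType.plus K) := Fintype.ofFinite _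

end Pairs

end

/-!
The torus `A = A(S, S⁺)` has the rational structure `E = Hom(S, K)^G` on its tangent space `ℂ^{S⁺}`:
a `ℚ`-basis of `E` is an `ℝ`-basis of `ℂ^{S⁺}` (`IsCMPair.isBaseChange`). This follows from the
independence of the evaluations `e ↦ e(s)` (Dedekind's lemma, `eq_zero_of_sum_mul_eq_zero`) and from
`dim_ℚ E = |S|` (Galois descent, `isBaseChange_val`). A Riemann form is `Tr(α u v̄)` for a totally
imaginary `α` in `E` whose sign at `S⁺` is prescribed (`IsCMPair.isAbelianVariety`).

An element of `End⁰(A)` is a linear map that preserves `E`, i.e. an equivariant matrix over `K`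
indexed by `S`, which has to respect `S = S⁺ ⊔ ιS⁺`. Its entry at `(s, t)` vanishes if some `g` moves
exactly one of `s` and `t` into `S⁺`. If `S` consists of the CM-types on `K`, then `gΦ ∈ S⁺` means
`g ∈ Φ`, so only the diagonal is left and `End⁰(A) = E` (`IsCMPair.exists_eq_mul`). Hence `A` is CM,
and it is split by `K` because `K ⊗ E = K^S`.

Let `B = W ⧸ M` be simple, CM and split by `K`. A nonzero element of `End⁰(B)` is injective on `W`, so
`End⁰(B)` embeds in the `ℚ`-span of `M`, whose dimension `2 dim B` is that of the étale subalgebra.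
Therefore `F = End⁰(B)` is a field, the span of `M` is a line `F m`, and being split means that there
is an embedding `ρ : F → K` (`IsSimple.exists_field`). Every embedding `σ` of `F` in `ℂ` is `g ρ` for
some `g` in `G`; it extends to an `ℝ`-linear form on `W` that is `ℂ`-linear or conjugate-linear, and
the `g` for which it is `ℂ`-linear form a CM-type `Φ` (`inducedCMType`). The stabilizer of `Φ` contains
the `g` that fix `ρ(F)`, so `e(Φ) ∈ ρ(F)` for `e` in `E`, and `e ↦ ρ⁻¹(e(Φ)) m` extends to a map
`ℂ^{S⁺} → W`. By the choice of `Φ` it is `ℂ`-linear (`IsCMPair.exists_projection`), by simplicity it is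
surjective, and its kernel is split off by the idempotent of `E` that belongs to the orbit of `Φ`
(`IsCMPair.isIsogenyFactor`).
-/

noncomputable section

/-! ### Denominators and rational structures -/

theorem mem_span_rat_iff {V : Type*} [AddCommGroup V] [Module ℚ V] (Λ : Submodule ℤ V) (v : V) :
    v ∈ Submodule.span ℚ (Λ : Set V) ↔ ∃ n : ℤ, n ≠ 0 ∧ n • v ∈ Λ := by
  constructor
  · intro hv
    induction hv using Submodule.span_induction with
    | mem x hx => exact ⟨1, one_ne_zero, by simpa using hx⟩
    | zero => exact ⟨1, one_ne_zero, by simp⟩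
    | add x y _ _ hx hy =>
      obtain ⟨n, hn, hx⟩ := hx
      obtain ⟨m, hm, hy⟩ := hy
      refine ⟨n * m, mul_ne_zero hn hm, ?_⟩
      have : (n * m) • (x + y) = m • n • x + n • m • y := by
        rw [smul_add, smul_smul, smul_smul, mul_comm m n]
      rw [this]
      exact Λ.add_mem (Λ.smul_mem _ hx) (Λ.smul_mem _ hy)
    | smul q x _ hx =>
      obtain ⟨n, hn, hx⟩ := hx
      refine ⟨q.den * n, mul_ne_zero (by exact_mod_cast q.den_ne_zero) hn, ?_⟩
      have : ((q.den : ℤ) * n) • q • x = q.num • n • x := by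
        simp only [← Int.cast_smul_eq_zsmul ℚ, smul_smul]
        congr 1
        push_cast
        have := Rat.den_mul_eq_num q
        rw [← this]; ring
      rw [this]
      exact Λ.smul_mem _ hx
  · rintro ⟨n, hn, h⟩
    have hn' : (n : ℚ) ≠ 0 := by exact_mod_cast hn
    have : v = (n : ℚ)⁻¹ • (n • v) := by
      rw [← Int.cast_smul_eq_zsmul ℚ, smul_smul, inv_mul_cancel₀ hn', one_smul]
    rw [this]
    exact Submodule.smul_mem _ _ (Submodule.subset_span h)

/-- Finitely many denominators suffice for a finitely generated group, so they have a common
multiple. -/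
theorem exists_common_denominator {A B : Type*} [AddCommGroup A] [AddCommGroup B]
    {Λ : Submodule ℤ A} (hΛ : Λ.FG) (M : Submodule ℤ B) (f : A →ₗ[ℤ] B)
    (h : ∀ a ∈ Λ, ∃ n : ℤ, n ≠ 0 ∧ n • f a ∈ M) :
    ∃ n : ℤ, n ≠ 0 ∧ ∀ a ∈ Λ, n • f a ∈ M := by
  classical
  obtain ⟨s, rfl⟩ := hΛ
  have h' : ∀ a : s, ∃ n : ℤ, n ≠ 0 ∧ n • f a ∈ M := fun a => h a (Submodule.subset_span a.2)
  choose n hn hnM using h'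
  refine ⟨∏ a : s, n a, Finset.prod_ne_zero_iff.2 fun a _ => hn a, fun a ha => ?_⟩
  induction ha using Submodule.span_induction with
  | mem x hx =>
    rw [← Finset.prod_erase_mul _ _ (Finset.mem_univ (⟨x, hx⟩ : s)), mul_smul]
    exact M.smul_mem _ (hnM ⟨x, hx⟩)
  | zero => simp
  | add x y _ _ hx hy => rw [map_add, smul_add]; exact M.add_mem hx hy
  | smul c x _ hx => rw [map_smul, smul_comm]; exact M.smul_mem _ hx

theorem isBaseChange_of_basis {R ι P V : Type*} [Field R] [Algebra ℚ R] [AddCommGroup P]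
    [Module ℚ P] [AddCommGroup V] [Module ℚ V] [Module R V] (j : P →ₗ[ℚ] V)
    (b : Module.Basis ι ℚ P) (b' : Module.Basis ι R V) (h : ∀ i, b' i = j (b i)) :
    IsBaseChange R j := by
  refine IsBaseChange.of_equiv ((b.baseChange R).equiv b' (Equiv.refl ι)) fun x => ?_
  have : ((((b.baseChange R).equiv b' (Equiv.refl ι)).toLinearMap.restrictScalars ℚ) ∘ₗ
      TensorProduct.mk ℚ R P 1) = j := by
    refine b.ext fun i => ?_
    have h1 := (b.baseChange R).equiv_apply i b' (Equiv.refl ι)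
    rw [Module.Basis.baseChange_apply] at h1
    simpa [h] using h1
  exact LinearMap.congr_fun this x

namespace ComplexTorus

variable {V : Type u} [NormedAddCommGroup V] [NormedSpace ℂ V]
variable {W : Type v} [NormedAddCommGroup W] [NormedSpace ℂ W]

/-! ### Homomorphisms of tori -/

theorem exists_ball_inter_eq_zero {B : Type*} [NormedAddCommGroup B] (M : Submodule ℤ B)
    [DiscreteTopology M] :
    ∃ ε > 0, ∀ m ∈ M, ‖m‖ < ε → m = 0 := by
  obtain ⟨ε, hε, h⟩ := Metric.exists_ball_inter_eq_singleton_of_mem_discrete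
    (isDiscrete_iff_discreteTopology.2 ‹_›) M.zero_mem
  refine ⟨ε, hε, fun m hm hlt => ?_⟩
  have : m ∈ Metric.ball (0 : B) ε ∩ M := ⟨by simpa using hlt, hm⟩
  rw [h] at this
  simpa using this

theorem tendsto_two_pow_inv_smul (v : V) :
    Filter.Tendsto (fun n : ℕ => ((2 : ℂ) ^ n)⁻¹ • v) Filter.atTop (𝓝 0) := by
  have h : Filter.Tendsto (fun n : ℕ => ((2 : ℂ)⁻¹) ^ n) Filter.atTop (𝓝 0) :=
    tendsto_pow_atTop_nhds_zero_of_norm_lt_one (by norm_num)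
  simpa using h.smul_const v

/-- A holomorphic homomorphism of tori is induced by a linear map, namely by the derivative at `0`
of a local lift `F`: near `0`, the difference of `F y - F 0` and `2 (F (y / 2) - F 0)` is small and
lies in the discrete group `M`, hence it vanishes. -/
theorem IsHolomorphic.exists_linear_lift {Λ : Submodule ℤ V} {M : Submodule ℤ W}
    [DiscreteTopology M] {f : V ⧸ Λ →+ W ⧸ M} (hf : IsHolomorphic f) :
    ∃ T : V →ₗ[ℂ] W, ∀ v, f (Submodule.Quotient.mk v) = Submodule.Quotient.mk (T v) := by
  obtain ⟨F, hF⟩ := hf 0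
  obtain ⟨ε, hε, hM⟩ := exists_ball_inter_eq_zero M
  have hd := hF.self_of_nhds.1
  have h0 : F 0 ∈ M := by
    rw [← Submodule.Quotient.mk_eq_zero, ← hF.self_of_nhds.2, Submodule.Quotient.mk_zero, map_zero]
  have hsmall : ∀ᶠ y in 𝓝 (0 : V), ‖F y - F 0‖ < ε / 3 := by
    have : Filter.Tendsto (fun y => ‖F y - F 0‖) (𝓝 0) (𝓝 0) := by
      simpa using (hd.continuousAt.sub (continuousAt_const (y := F 0))).norm.tendsto
    exact this.eventually (gt_mem_nhds (by positivity))
  obtain ⟨δ, hδ, hball⟩ := Metric.eventually_nhds_iff.1 (hF.and hsmall)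
  simp only [dist_zero_right] at hball
  have hhalf : ∀ y : V, ‖(2 : ℂ)⁻¹ • y‖ ≤ ‖y‖ := fun y => by
    rw [norm_smul]; norm_num; linarith [norm_nonneg y]
  have hdouble : ∀ y : V, ‖y‖ < δ → F y - F 0 = (2 : ℂ) • (F ((2 : ℂ)⁻¹ • y) - F 0) := by
    intro y hy
    have h1 := hball hy
    have h2 := hball ((hhalf y).trans_lt hy)
    rw [eq_comm, ← sub_eq_zero]
    apply hM
    · rw [← Submodule.Quotient.mk_eq_zero, two_smul]
      simp only [Submodule.Quotient.mk_sub, Submodule.Quotient.mk_add, ← h1.1.2, ← h2.1.2,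
        (Submodule.Quotient.mk_eq_zero M).2 h0, sub_zero]
      rw [← map_add, ← Submodule.Quotient.mk_add, ← two_smul ℂ, smul_smul,
        mul_inv_cancel₀ two_ne_zero, one_smul, sub_self]
    · refine (norm_sub_le _ _).trans_lt ?_
      rw [norm_smul]
      norm_num
      linarith [h1.2, h2.2]
  have hpow : ∀ (n : ℕ) (y : V), ‖y‖ < δ →
      F y - F 0 = (2 : ℂ) ^ n • (F (0 + ((2 : ℂ) ^ n)⁻¹ • y) - F 0) := by
    intro n
    induction n with
    | zero => intro y _; simp
    | succ n ih =>
      intro y hy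
      rw [hdouble y hy, ih _ ((hhalf y).trans_lt hy), smul_smul, smul_smul, pow_succ', mul_inv_rev]
  -- `2 ^ n • (F (2⁻ⁿ y) - F 0)` does not depend on `n`, and it tends to the derivative at `y`.
  have hlin : ∀ y : V, ‖y‖ < δ → F y - F 0 = fderiv ℂ F 0 y := by
    intro y hy
    have hlim := hd.hasFDerivAt.lim y (c := fun n : ℕ => (2 : ℂ) ^ n) (l := Filter.atTop) (by
      simpa using tendsto_pow_atTop_atTop_of_one_lt (one_lt_two (α := ℝ)))
    simp_rw [← hpow _ y hy] at hlim
    exact tendsto_nhds_unique tendsto_const_nhds hlim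
  refine ⟨fderiv ℂ F 0, fun v => ?_⟩
  obtain ⟨n, hn⟩ := ((tendsto_two_pow_inv_smul v).eventually (Metric.ball_mem_nhds 0 hδ)).exists
  have hn' : ‖((2 : ℂ) ^ n)⁻¹ • v‖ < δ := by simpa using hn
  have hv : v = (2 ^ n : ℕ) • ((2 : ℂ) ^ n)⁻¹ • v := by
    rw [← Nat.cast_smul_eq_nsmul ℂ, smul_smul]; simp
  have h1 := (hball hn').1.2
  rw [sub_eq_iff_eq_add.1 (hlin _ hn'), Submodule.Quotient.mk_add,
    (Submodule.Quotient.mk_eq_zero M).2 h0, add_zero] at h1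
  rw [hv, Submodule.Quotient.mk_smul, map_nsmul, h1, ContinuousLinearMap.coe_coe, map_nsmul,
    Submodule.Quotient.mk_smul]

theorem eq_zero_of_forall_mem {M : Submodule ℤ W} [DiscreteTopology M] (T : V →ₗ[ℂ] W)
    (h : ∀ v, T v ∈ M) : T = 0 := by
  ext v
  obtain ⟨ε, hε, hM⟩ := exists_ball_inter_eq_zero M
  obtain ⟨n, hn⟩ :=
    ((tendsto_two_pow_inv_smul (T v)).eventually (Metric.ball_mem_nhds 0 hε)).exists
  have h0 : ((2 : ℂ) ^ n)⁻¹ • T v = 0 :=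
    hM _ (by rw [← map_smul]; exact h _) (by simpa using hn)
  simpa using h0

/-- The homomorphism of tori induced by a linear map that respects the lattices. -/
def homOfLinear {Λ : Submodule ℤ V} {M : Submodule ℤ W} (T : V →ₗ[ℂ] W)
    (h : ∀ v ∈ Λ, T v ∈ M) : V ⧸ Λ →+ W ⧸ M :=
  (Submodule.mapQ Λ M (T.restrictScalars ℤ) h).toAddMonoidHom

theorem homOfLinear_mk {Λ : Submodule ℤ V} {M : Submodule ℤ W} (T : V →ₗ[ℂ] W)
    (h : ∀ v ∈ Λ, T v ∈ M) (v : V) :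
    homOfLinear T h (Submodule.Quotient.mk v) = Submodule.Quotient.mk (T v) := rfl

theorem isHolomorphic_homOfLinear [FiniteDimensional ℂ V] {Λ : Submodule ℤ V} {M : Submodule ℤ W}
    (T : V →ₗ[ℂ] W) (h : ∀ v ∈ Λ, T v ∈ M) : IsHolomorphic (homOfLinear T h) :=
  fun _ => ⟨T, Filter.Eventually.of_forall fun _ =>
    ⟨(LinearMap.toContinuousLinearMap T).differentiableAt, rfl⟩⟩

/-- A linear isomorphism that identifies the rational spans of two lattices becomes an isogeny after
multiplication by a common denominator. -/
theorem isogenous_of_linear [FiniteDimensional ℂ V] [Module ℚ V] [Module ℚ W]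
    {Λ : Submodule ℤ V} {M : Submodule ℤ W} (hΛ : Λ.FG) (hM : M.FG) (T : V ≃ₗ[ℂ] W)
    (hT : ∀ v, T v ∈ Submodule.span ℚ (M : Set W) ↔ v ∈ Submodule.span ℚ (Λ : Set V)) :
    Isogenous Λ M := by
  obtain ⟨n, hn, hnM⟩ := exists_common_denominator hΛ M (T.toLinearMap.restrictScalars ℤ)
    fun v hv => (mem_span_rat_iff M _).1 ((hT v).2 (Submodule.subset_span hv))
  have hn' : (n : ℂ) ≠ 0 := by exact_mod_cast hn
  have hmem : ∀ v ∈ Λ, ((n : ℂ) • T.toLinearMap) v ∈ M := fun v hv => by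
    simpa [Int.cast_smul_eq_zsmul] using hnM v hv
  refine ⟨homOfLinear _ hmem, isHolomorphic_homOfLinear _ _, ?_, ?_⟩
  · intro x
    obtain ⟨w, rfl⟩ := Submodule.Quotient.mk_surjective M x
    refine ⟨Submodule.Quotient.mk (T.symm ((n : ℂ)⁻¹ • w)), ?_⟩
    rw [homOfLinear_mk]
    simp [smul_smul, inv_mul_cancel₀ hn']
  · -- The kernel is a quotient of `M`, and every element of it is torsion.
    let e : W →ₗ[ℤ] V ⧸ Λ :=
      Λ.mkQ ∘ₗ ((n : ℂ)⁻¹ • T.symm.toLinearMap).restrictScalars ℤ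
    have he : ∀ v, e ((n : ℂ) • T v) = Submodule.Quotient.mk v := fun v => by
      simp [e, smul_smul, inv_mul_cancel₀ hn']
    have hfg : (M.map e).FG := hM.map e
    have hker : ∀ x ∈ (homOfLinear _ hmem).ker, x ∈ M.map e := by
      intro x hx
      obtain ⟨v, rfl⟩ := Submodule.Quotient.mk_surjective Λ x
      rw [AddMonoidHom.mem_ker, homOfLinear_mk, Submodule.Quotient.mk_eq_zero] at hx
      exact ⟨_, hx, he v⟩
    have : Module.Finite ℤ (M.map e) := Module.Finite.iff_fg.2 hfg
    have hfin : Finite (M.map e) := by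
      apply Module.finite_of_fg_torsion
      rintro ⟨x, w, hw, rfl⟩
      have h1 : (n : ℂ)⁻¹ • T.symm w ∈ Submodule.span ℚ (Λ : Set V) := by
        rw [← hT, mem_span_rat_iff]
        refine ⟨n, hn, ?_⟩
        rw [← Int.cast_smul_eq_zsmul ℂ, map_smul, smul_smul, mul_inv_cancel₀ hn', one_smul]
        simpa using hw
      obtain ⟨m, hm, h2⟩ := (mem_span_rat_iff _ _).1 h1
      refine ⟨⟨m, mem_nonZeroDivisors_of_ne_zero hm⟩, Subtype.ext ?_⟩
      change m • e w = 0
      exact (Submodule.Quotient.mk_eq_zero Λ).2 h2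
    exact Finite.of_injective (fun x : (homOfLinear _ hmem).ker =>
      (⟨x.1, hker _ x.2⟩ : M.map e)) fun x y h => Subtype.ext (by simpa using h)

/-! ### The rational endomorphism algebra -/

/-- The `ℂ`-linear endomorphisms of `V` that map the rational span of `Λ` to itself. This is
`End⁰(V ⧸ Λ)` realized on the tangent space, see `endZeroEquiv`. -/
def ratEnd [Module ℚ V] (Λ : Submodule ℤ V) : Subalgebra ℚ (Module.End ℂ V) where
  carrier := {T | ∀ v ∈ Submodule.span ℚ (Λ : Set V), T v ∈ Submodule.span ℚ (Λ : Set V)}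
  mul_mem' := fun ha hb v hv => ha _ (hb _ hv)
  add_mem' := fun ha hb v hv => Submodule.add_mem _ (ha _ hv) (hb _ hv)
  algebraMap_mem' := fun r v hv => by
    rw [Module.algebraMap_end_apply]
    exact Submodule.smul_mem _ _ hv

theorem exists_lift_End (Λ : Submodule ℤ V) [DiscreteTopology Λ] (f : End Λ) :
    ∃ T : V →ₗ[ℂ] V, ∀ v : V, (f.1 : V ⧸ Λ →+ V ⧸ Λ) (Submodule.Quotient.mk v) =
      Submodule.Quotient.mk (T v) :=
  IsHolomorphic.exists_linear_lift f.2

theorem lift_End_unique {Λ : Submodule ℤ V} [DiscreteTopology Λ] {T T' : Module.End ℂ V}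
    (h : ∀ v, (Submodule.Quotient.mk (T v) : V ⧸ Λ) = Submodule.Quotient.mk (T' v)) : T = T' := by
  rw [← sub_eq_zero]
  refine eq_zero_of_forall_mem (M := Λ) _ fun v => ?_
  rw [LinearMap.sub_apply, ← Submodule.Quotient.eq]
  exact h v

/-- The action of `End(V ⧸ Λ)` on the tangent space `V`. -/
def liftEnd [Module ℚ V] (Λ : Submodule ℤ V) [DiscreteTopology Λ] : End Λ →+* ratEnd Λ where
  toFun f := ⟨(exists_lift_End Λ f).choose, fun v hv => by
    rw [mem_span_rat_iff] at hv ⊢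
    obtain ⟨n, hn, hv⟩ := hv
    refine ⟨n, hn, ?_⟩
    rw [← map_zsmul, ← Submodule.Quotient.mk_eq_zero, ← (exists_lift_End Λ f).choose_spec,
      (Submodule.Quotient.mk_eq_zero Λ).2 hv, map_zero]⟩
  map_one' := Subtype.ext <| lift_End_unique (Λ := Λ) fun v =>
    ((exists_lift_End Λ 1).choose_spec v).symm
  map_mul' f g := Subtype.ext <| lift_End_unique (Λ := Λ) fun v => by
    refine ((exists_lift_End Λ (f * g)).choose_spec v).symm.trans ?_
    refine Eq.trans ?_ ((exists_lift_End Λ f).choose_spec _)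
    rw [← (exists_lift_End Λ g).choose_spec]
    rfl
  map_zero' := Subtype.ext <| lift_End_unique (Λ := Λ) fun v =>
    ((exists_lift_End Λ 0).choose_spec v).symm
  map_add' f g := Subtype.ext <| lift_End_unique (Λ := Λ) fun v => by
    refine ((exists_lift_End Λ (f + g)).choose_spec v).symm.trans ?_
    refine Eq.trans ?_ (congrArg₂ (fun a b : V ⧸ Λ => a + b)
      ((exists_lift_End Λ f).choose_spec v) ((exists_lift_End Λ g).choose_spec v))
    rfl

theorem mk_liftEnd [Module ℚ V] (Λ : Submodule ℤ V) [DiscreteTopology Λ] (f : End Λ) (v : V) :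
    (Submodule.Quotient.mk ((liftEnd Λ f).1 v) : V ⧸ Λ) =
      (f.1 : V ⧸ Λ →+ V ⧸ Λ) (Submodule.Quotient.mk v) :=
  ((exists_lift_End Λ f).choose_spec v).symm

/-- `ratEnd Λ` arises from `End Λ` by inverting the nonzero integers. -/
theorem isLocalizedModule_liftEnd [FiniteDimensional ℂ V] [Module ℚ V] (Λ : Submodule ℤ V)
    [DiscreteTopology Λ] (hΛ : Λ.FG) :
    IsLocalizedModule (nonZeroDivisors ℤ) (liftEnd Λ).toIntAlgHom.toLinearMap where
  map_units n := by
    have hn : ((n : ℤ) : ℚ) ≠ 0 := by exact_mod_cast nonZeroDivisors.ne_zero n.2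
    rw [Module.End.isUnit_iff]
    have : ∀ x : ratEnd Λ, (algebraMap ℤ (Module.End ℤ (ratEnd Λ)) n) x = ((n : ℤ) : ℚ) • x :=
      fun x => by rw [Module.algebraMap_end_apply, Int.cast_smul_eq_zsmul]
    refine ⟨fun x y h => ?_, fun y => ⟨((n : ℤ) : ℚ)⁻¹ • y, ?_⟩⟩
    · rw [this, this] at h
      exact smul_right_injective _ hn h
    · rw [this, smul_smul, mul_inv_cancel₀ hn, one_smul]
  surj T := by
    obtain ⟨n, hn, h⟩ := exists_common_denominator hΛ Λ (T.1.restrictScalars ℤ)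
      fun v hv => (mem_span_rat_iff Λ _).1 (T.2 v (Submodule.subset_span hv))
    have hT : ∀ v ∈ Λ, (n • T.1) v ∈ Λ := h
    refine ⟨(⟨homOfLinear (n • T.1) hT, isHolomorphic_homOfLinear _ _⟩,
      ⟨n, mem_nonZeroDivisors_of_ne_zero hn⟩), ?_⟩
    refine Subtype.ext <| lift_End_unique (Λ := Λ) fun v => ?_
    exact (mk_liftEnd Λ ⟨homOfLinear (n • T.1) hT, isHolomorphic_homOfLinear _ _⟩ v).symm
  exists_of_eq {f g} h := by
    refine ⟨1, ?_⟩
    rw [one_smul, one_smul]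
    refine Subtype.ext (AddMonoidHom.ext fun x => ?_)
    obtain ⟨v, rfl⟩ := Submodule.Quotient.mk_surjective Λ x
    have h' : liftEnd Λ f = liftEnd Λ g := h
    refine (mk_liftEnd Λ f v).symm.trans (Eq.trans ?_ (mk_liftEnd Λ g v))
    rw [h']

/-- `End⁰(V ⧸ Λ)` as an algebra of endomorphisms of the tangent space. -/
def endZeroEquiv [FiniteDimensional ℂ V] [Module ℚ V] (Λ : Submodule ℤ V)
    [DiscreteTopology Λ] (hΛ : Λ.FG) : EndZero Λ ≃ₐ[ℚ] ratEnd Λ := by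
  let φ : EndZero Λ →ₐ[ℚ] ratEnd Λ := Algebra.TensorProduct.lift (Algebra.ofId ℚ (ratEnd Λ))
    (liftEnd Λ).toIntAlgHom fun q f => Algebra.commutes q _
  have := isLocalizedModule_liftEnd Λ hΛ
  have hbc : IsBaseChange ℚ (liftEnd Λ).toIntAlgHom.toLinearMap :=
    IsLocalizedModule.isBaseChange (nonZeroDivisors ℤ) ℚ _
  have h : φ.toLinearMap = hbc.equiv.toLinearMap := by
    refine TensorProduct.AlgebraTensorModule.curry_injective (LinearMap.ext_ring ?_)
    refine LinearMap.ext fun f => ?_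
    change φ (1 ⊗ₜ[ℤ] f) = hbc.equiv (1 ⊗ₜ[ℤ] f)
    rw [hbc.equiv_tmul, one_smul]
    exact (Algebra.TensorProduct.lift_tmul _ _ _ _ _).trans (by rw [map_one, one_mul]; rfl)
  refine AlgEquiv.ofBijective φ ?_
  have h2 : (φ : EndZero Λ → ratEnd Λ) = hbc.equiv := funext fun x => LinearMap.congr_fun h x
  rw [h2]
  exact hbc.equiv.bijective

/-! ### Abelian varieties -/

/-- A positive form that is integral on `Λ` separates the elements of `Λ` near `0`: a small `v` in `Λ`
pairs to integers of absolute value less than `1` with a basis of `V` taken from `Λ`, so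
`ψ v = 0`. -/
theorem discreteTopology_of_riemannForm [FiniteDimensional ℂ V] (Λ : Submodule ℤ V)
    (hspan : Submodule.span ℝ (Λ : Set V) = ⊤) (ψ : V →ₗ[ℝ] V →ₗ[ℝ] ℝ)
    (hint : ∀ u ∈ Λ, ∀ v ∈ Λ, ∃ n : ℤ, ψ u v = n)
    (hpos : ∀ u, u ≠ 0 → 0 < ψ (Complex.I • u) u) : DiscreteTopology Λ := by
  have : FiniteDimensional ℝ V := FiniteDimensional.complexToReal V
  obtain ⟨s, hsΛ, hs, hli⟩ := exists_linearIndependent ℝ (Λ : Set V)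
  have hfin : Finite s := hli.setFinite
  have hev : ∀ᶠ v in 𝓝 (0 : V), ∀ b : s, |ψ v b| < 1 := by
    refine Filter.eventually_all.2 fun b => ?_
    have hc : Continuous fun v => |ψ v b| :=
      (LinearMap.continuous_of_finiteDimensional (ψ.flip b.1)).abs
    have : Filter.Tendsto (fun v => |ψ v b|) (𝓝 0) (𝓝 0) := by simpa using hc.tendsto 0
    exact this.eventually (gt_mem_nhds one_pos)
  have hzero : ∀ v ∈ Λ, (∀ b : s, |ψ v b| < 1) → v = 0 := by
    intro v hv h
    have h1 : ψ v = 0 := by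
      refine LinearMap.ext_on (hs.trans hspan) fun b hb => ?_
      obtain ⟨n, hn⟩ := hint v hv b (hsΛ hb)
      have h2 := h ⟨b, hb⟩
      rw [hn] at h2 ⊢
      have h3 : |n| < 1 := by exact_mod_cast h2
      rw [Int.abs_lt_one_iff.1 h3]
      simp
    by_contra hv0
    have h2 := hpos (Complex.I • v) (smul_ne_zero Complex.I_ne_zero hv0)
    rw [smul_smul, Complex.I_mul_I, neg_one_smul, map_neg, h1] at h2
    simp at h2
  rw [discreteTopology_iff_isOpen_singleton_zero, isOpen_singleton_iff_nhds_eq_pure]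
  refine le_antisymm ?_ (pure_le_nhds _)
  rw [Filter.le_pure_iff, nhds_subtype_eq_comap]
  refine ⟨_, hev, fun v hv => ?_⟩
  exact Subtype.ext (hzero v.1 v.2 hv)

/-- For a finitely generated `Λ`, it suffices to have a Riemann form with rational values. -/
theorem isAbelianVariety_of_rational [FiniteDimensional ℂ V] {Λ : Submodule ℤ V} (hΛ : Λ.FG)
    (hspan : Submodule.span ℝ (Λ : Set V) = ⊤) (ψ : V →ₗ[ℝ] V →ₗ[ℝ] ℝ)
    (halt : ∀ u, ψ u u = 0) (hrat : ∀ u ∈ Λ, ∀ v ∈ Λ, ∃ q : ℚ, ψ u v = q)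
    (hI : ∀ u v, ψ (Complex.I • u) (Complex.I • v) = ψ u v)
    (hpos : ∀ u, u ≠ 0 → 0 < ψ (Complex.I • u) u) : IsAbelianVariety Λ := by
  let Z : Submodule ℤ ℝ := LinearMap.range (Algebra.linearMap ℤ ℝ)
  let M : Submodule ℤ (V →ₗ[ℝ] ℝ) :=
    { carrier := {h | ∀ v ∈ Λ, h v ∈ Z}
      add_mem' := fun ha hb v hv => Z.add_mem (ha v hv) (hb v hv)
      zero_mem' := fun v _ => Z.zero_mem
      smul_mem' := fun c _ ha v hv => Z.smul_mem c (ha v hv) }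
  obtain ⟨n, hn, h⟩ := exists_common_denominator hΛ M (ψ.restrictScalars ℤ) fun u hu => by
    refine exists_common_denominator (B := ℝ) hΛ Z ((ψ u).restrictScalars ℤ) fun v hv => ?_
    obtain ⟨q, hq⟩ := hrat u hu v hv
    refine ⟨q.den, by exact_mod_cast q.den_ne_zero, q.num, ?_⟩
    have := Rat.den_mul_eq_num q
    change (q.num : ℝ) = (q.den : ℤ) • ψ u v
    rw [hq, zsmul_eq_mul]
    exact_mod_cast this.symm
  -- The form is scaled by `n ^ 2` and not by `n`, whose sign may be wrong.
  have hn2 : (0 : ℝ) < (n : ℝ) ^ 2 := by positivity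
  have hint : ∀ u ∈ Λ, ∀ v ∈ Λ, ∃ m : ℤ, (((n : ℝ) ^ 2) • ψ) u v = m := by
    intro u hu v hv
    obtain ⟨m, hm⟩ := h u hu v hv
    refine ⟨n * m, ?_⟩
    have hm' : (m : ℝ) = n • ψ u v := hm
    simp only [LinearMap.smul_apply, smul_eq_mul]
    push_cast
    rw [hm', zsmul_eq_mul]
    ring
  have hpos' : ∀ u, u ≠ 0 → 0 < (((n : ℝ) ^ 2) • ψ) (Complex.I • u) u := fun u hu => by
    simp only [LinearMap.smul_apply, smul_eq_mul]
    exact mul_pos hn2 (hpos u hu)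
  exact ⟨discreteTopology_of_riemannForm Λ hspan _ hint hpos', hspan, _,
    fun u => by simp [halt], hint, fun u v => by simp [hI], hpos'⟩

theorem IsAbelianVariety.fg [FiniteDimensional ℂ V] {Λ : Submodule ℤ V} (h : IsAbelianVariety Λ) :
    Λ.FG := by
  have := h.discrete
  have : FiniteDimensional ℝ V := FiniteDimensional.complexToReal V
  have : IsZLattice ℝ Λ := ⟨h.span_eq_top⟩
  exact ZLattice.FG ℝ Λ

/-- A complex subspace spanned by its lattice vectors is the tangent space of an abelian
subvariety. -/
theorem IsAbelianVariety.comap_subtype [FiniteDimensional ℂ V] {Λ : Submodule ℤ V}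
    (h : IsAbelianVariety Λ) (U : Submodule ℂ V)
    (hU : ∀ u ∈ U, u ∈ Submodule.span ℝ ((U : Set V) ∩ Λ)) :
    IsAbelianVariety (Λ.comap (U.subtype.restrictScalars ℤ)) := by
  obtain ⟨ψ, halt, hint, hI, hpos⟩ := h.polarizable
  let j : U →ₗ[ℝ] V := U.subtype.restrictScalars ℝ
  have hspan : Submodule.span ℝ ((Λ.comap (U.subtype.restrictScalars ℤ) : Submodule ℤ U) : Set U) =
      ⊤ := by
    refine Submodule.eq_top_iff'.2 fun u => ?_
    have h1 : j u ∈ Submodule.span ℝ (j '' (Λ.comap (U.subtype.restrictScalars ℤ))) := by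
      refine Submodule.span_mono ?_ (hU u.1 u.2)
      rintro x ⟨hx, hx'⟩
      exact ⟨⟨x, hx⟩, hx', rfl⟩
    rw [← Submodule.map_span] at h1
    obtain ⟨u', hu', h2⟩ := h1
    rwa [← Subtype.ext h2]
  have hint' : ∀ u ∈ Λ.comap (U.subtype.restrictScalars ℤ),
      ∀ v ∈ Λ.comap (U.subtype.restrictScalars ℤ), ∃ n : ℤ, (ψ.compl₁₂ j j) u v = n :=
    fun u hu v hv => hint _ hu _ hv
  have hpos' : ∀ u : U, u ≠ 0 → 0 < (ψ.compl₁₂ j j) (Complex.I • u) u := fun u hu =>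
    hpos _ (by simpa using hu)
  exact ⟨discreteTopology_of_riemannForm _ hspan _ hint' hpos', hspan, ψ.compl₁₂ j j,
    fun u => halt _, hint', fun u v => hI _ _, hpos'⟩

/-- The rational span of the lattice of an abelian variety is a rational structure on the tangent
space. -/
theorem IsAbelianVariety.isBaseChange [FiniteDimensional ℂ V] [Module ℚ V] {Λ : Submodule ℤ V}
    (h : IsAbelianVariety Λ) : IsBaseChange ℝ (Submodule.span ℚ (Λ : Set V)).subtype := by
  have := h.discrete
  have : FiniteDimensional ℝ V := FiniteDimensional.complexToReal V
  have : IsZLattice ℝ Λ := ⟨h.span_eq_top⟩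
  have := ZLattice.module_free ℝ Λ
  let b := (Module.Free.chooseBasis ℤ Λ).ofZLatticeBasis ℝ Λ
  have hb : Submodule.span ℚ (Λ : Set V) = Submodule.span ℚ (Set.range b) :=
    (congrArg (fun L : Submodule ℤ V => Submodule.span ℚ (L : Set V))
      ((Module.Free.chooseBasis ℤ Λ).ofZLatticeBasis_span ℝ Λ)).symm.trans
        (Submodule.span_span_of_tower ℤ ℚ _)
  rw [hb]
  exact isBaseChange_of_basis _ (b.restrictScalars ℚ) b fun i => (b.restrictScalars_apply ℚ i).symm

end ComplexTorus

/-! ### Equivariant maps -/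

theorem map_eq_sum_single {ι R M : Type*} [Fintype ι] [DecidableEq ι] [Semiring R]
    [AddCommMonoid M] [Module R M] (f : (ι → R) →ₗ[R] M) (v : ι → R) :
    f v = ∑ i, v i • f (Pi.single i 1) := by
  rw [LinearMap.pi_apply_eq_sum_univ f v]
  refine Finset.sum_congr rfl fun i _ => ?_
  congr 2
  funext j
  simp [Pi.single_apply, eq_comm]


section Equivariant

open ComplexTorus

theorem equivariantMaps_smul {K : Subfield ℂ} {S : Type*} [MulAction Gal(K/ℚ) S]
    (e : equivariantMaps K S) (g : Gal(K/ℚ)) (s : S) :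
    (e : S → K) (g • s) = g ((e : S → K) s) := e.2 g s

variable {K : Subfield ℂ} [NumberField K] {S : Type*} [MulAction Gal(K/ℚ) S]

/-- The equivariant map `x ↦ ∑ g a`, summed over the `g` with `g • s = x`: the average of the map
that is `a` at `s` and `0` elsewhere. -/
def orbitSum [DecidableEq S] (a : K) (s : S) : equivariantMaps K S :=
  ⟨fun x => ∑ g : Gal(K/ℚ), if g • s = x then g a else 0, fun h x => by
    rw [map_sum]
    refine (Fintype.sum_bijective (h * ·) (Group.mulLeft_bijective h) _ _ fun g => ?_).symm
    simp only [mul_smul, smul_left_cancel_iff, AlgEquiv.mul_apply]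
    split_ifs <;> simp⟩

/-- The evaluations `e ↦ e(s)` are linearly independent, with coefficients in any field that
contains `K`. On the maps `orbitSum a s` a linear relation becomes one between the elements of the
Galois group, so that Dedekind's lemma applies. -/
theorem eq_zero_of_sum_mul_eq_zero [Fintype S] {L : Type*} [Field L] (φ : K →+* L) (c : S → L)
    (h : ∀ e : equivariantMaps K S, ∑ s, c s * φ ((e : S → K) s) = 0) : c = 0 := by
  classical
  funext s
  let χ : Gal(K/ℚ) → (K →* L) := fun g => (φ.comp (g : K →+* K) : K →+* L)
  have hχ : Function.Injective χ := fun g g' hg => by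
    ext x
    exact congrArg Subtype.val (φ.injective (DFunLike.congr_fun hg x))
  have hli := (linearIndependent_monoidHom K L).comp χ hχ
  rw [Fintype.linearIndependent_iff] at hli
  have h1 := hli (fun g => c (g • s)) (by
    funext a
    have h2 := h (orbitSum a s)
    simp only [orbitSum, map_sum, Finset.mul_sum] at h2
    rw [Finset.sum_comm] at h2
    simpa [apply_ite φ, χ] using h2) 1
  simpa using h1

theorem span_eq_top_of_basis [Fintype S] {L : Type*} [Field L] (φ : K →+* L) {κ : Type*}
    (b : Module.Basis κ ℚ (equivariantMaps K S)) :
    Submodule.span L (Set.range fun i s => φ ((b i : S → K) s)) = ⊤ := by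
  classical
  by_contra hne
  obtain ⟨f, hf, hle⟩ := Submodule.exists_le_ker_of_lt_top _ (lt_top_iff_ne_top.2 hne)
  have hval : ∀ v : S → L, f v = ∑ s, f (Pi.single s 1) * v s := fun v => by
    rw [map_eq_sum_single f v]
    exact Finset.sum_congr rfl fun s _ => mul_comm _ _
  apply hf
  have h0 := eq_zero_of_sum_mul_eq_zero φ (fun s => f (Pi.single s 1)) fun e => by
    rw [← hval fun s => φ ((e : S → K) s)]
    have : CharZero L := charZero_of_injective_ringHom φ.injective
    let ev : equivariantMaps K S →ₗ[ℚ] (S → L) :=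
      { toFun := fun e s => φ ((e : S → K) s)
        map_add' := fun a b => by ext; simp
        map_smul' := fun q a => by ext; simp [Algebra.smul_def] }
    have hz : (f.restrictScalars ℚ) ∘ₗ ev = 0 :=
      b.ext fun i => hle (Submodule.subset_span ⟨i, rfl⟩)
    exact LinearMap.congr_fun hz e
  ext v
  simpa using congrFun h0 v

/-- Equivariant maps that are linearly independent over `ℚ` are so over `K`: apply to a relation
`∑ k i • b i = 0` the traces of its multiples. -/
theorem linearIndependent_of_basis [IsGalois ℚ K] {κ : Type*} [Fintype κ]
    (b : Module.Basis κ ℚ (equivariantMaps K S)) :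
    LinearIndependent K fun i => (b i : S → K) := by
  rw [Fintype.linearIndependent_iff]
  intro k hk i
  have htr : ∀ a : K, Algebra.trace ℚ K (k i * a) = 0 := by
    intro a
    refine Fintype.linearIndependent_iff.1 b.linearIndependent
      (fun j => Algebra.trace ℚ K (k j * a)) (Subtype.ext (funext fun s => ?_)) i
    have hk' : ∀ g : Gal(K/ℚ), ∑ j, g (k j) * (b j : S → K) s = 0 := fun g => by
      have h1 := congrArg g (congrFun hk (g⁻¹ • s))
      simpa [map_sum, ← equivariantMaps_smul] using h1
    have h2 : ∑ j, algebraMap ℚ K (Algebra.trace ℚ K (k j * a)) * (b j : S → K) s = 0 := by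
      simp_rw [trace_eq_sum_automorphisms, Finset.sum_mul]
      rw [Finset.sum_comm]
      refine Finset.sum_eq_zero fun g _ => ?_
      rw [← mul_zero (g a), ← hk' g, Finset.mul_sum]
      exact Finset.sum_congr rfl fun j _ => by rw [map_mul]; ring
    simpa [Algebra.smul_def] using h2
  exact (traceForm_nondegenerate ℚ K).1 (k i) fun a => htr a

instance [Finite S] : FiniteDimensional ℚ (equivariantMaps K S) :=
  FiniteDimensional.of_injective (equivariantMaps K S).val.toLinearMap Subtype.val_injective

/-- Galois descent: `K ⊗ Hom(S, K)^G = Hom(S, K)`. -/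
theorem isBaseChange_val [IsGalois ℚ K] [Finite S] :
    IsBaseChange K (equivariantMaps K S).val.toLinearMap := by
  have := Fintype.ofFinite S
  let b := Module.finBasis ℚ (equivariantMaps K S)
  exact isBaseChange_of_basis _ b (Module.Basis.mk (linearIndependent_of_basis b)
    (span_eq_top_of_basis (RingHom.id K) b).ge) fun i => by simp

theorem finrank_equivariantMaps [IsGalois ℚ K] [Fintype S] :
    Module.finrank ℚ (equivariantMaps K S) = Fintype.card S := by
  let b := Module.finBasis ℚ (equivariantMaps K S)
  have h := Module.finrank_eq_card_basis ((isBaseChange_val (K := K) (S := S)).basis b)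
  simpa using h.symm

/-- The isomorphism `K ⊗ Hom(S, K)^G ≃ Hom(S, K)` of algebras. -/
def tensorEquivariantMapsEquiv (K : Subfield ℂ) [NumberField K] [IsGalois ℚ K] (S : Type*)
    [MulAction Gal(K/ℚ) S] [Finite S] : K ⊗[ℚ] equivariantMaps K S ≃ₐ[K] (S → K) := by
  let φ : K ⊗[ℚ] equivariantMaps K S →ₐ[K] (S → K) := Algebra.TensorProduct.lift
    (Algebra.ofId K (S → K)) (equivariantMaps K S).val fun _ _ => mul_comm _ _
  have hbc := isBaseChange_val (K := K) (S := S)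
  have h : φ.toLinearMap = hbc.equiv.toLinearMap := by
    refine TensorProduct.AlgebraTensorModule.curry_injective (LinearMap.ext_ring ?_)
    refine LinearMap.ext fun f => ?_
    change φ (1 ⊗ₜ[ℚ] f) = hbc.equiv (1 ⊗ₜ[ℚ] f)
    rw [hbc.equiv_tmul, one_smul]
    exact (Algebra.TensorProduct.lift_tmul _ _ _ _ _).trans (by rw [map_one, one_mul]; rfl)
  refine AlgEquiv.ofBijective φ ?_
  have h2 : (φ : K ⊗[ℚ] equivariantMaps K S → (S → K)) = hbc.equiv :=
    funext fun x => LinearMap.congr_fun h x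
  rw [h2]
  exact hbc.equiv.bijective

/-- `E` becomes the split algebra `Hom(S, K)` over `K`, and being étale descends. -/
theorem etale_equivariantMaps [IsGalois ℚ K] [Finite S] :
    Algebra.Etale ℚ (equivariantMaps K S) := by
  have : Algebra.Etale K (K ⊗[ℚ] equivariantMaps K S) :=
    Algebra.Etale.of_equiv (tensorEquivariantMapsEquiv K S).symm
  exact Algebra.Etale.of_etale_tensorProduct_of_faithfullyFlat K

theorem exists_isLattice (K : Subfield ℂ) [NumberField K] (S : Type*)
    [MulAction Gal(K/ℚ) S] [Finite S] :
    ∃ Λ : Submodule ℤ (equivariantMaps K S), IsLattice K S Λ := by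
  let b := Module.finBasis ℚ (equivariantMaps K S)
  refine ⟨Submodule.span ℤ (Set.range b), Submodule.fg_span (Set.finite_range b), ?_⟩
  rw [Submodule.span_span_of_tower, b.span_eq]

end Equivariant

theorem exists_rat_of_forall_apply_eq {K : Subfield ℂ} [NumberField K] [IsGalois ℚ K] (x : K)
    (h : ∀ g : Gal(K/ℚ), g x = x) :
    ∃ q : ℚ, (x : ℂ) = q := by
  obtain ⟨q, rfl⟩ := IsGalois.mem_bot_iff_fixed x |>.2 h
  exact ⟨q, by simp⟩

/-! ### Pairs -/

section CMPair

open ComplexTorus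

variable {K : Subfield ℂ} [NumberField K] [NumberField.IsCMField K]
  {S : Type*} [MulAction Gal(K/ℚ) S] {Sp : Set S}

theorem equivariantMaps_conj_smul (e : equivariantMaps K S) (s : S) :
    (((e : S → K) (conjGal K • s) : K) : ℂ) = (starRingEnd ℂ) ((e : S → K) s : ℂ) := by
  rw [equivariantMaps_smul]
  exact apply_conjGal K.subtype _

theorem IsCMPair.mem_or (hS : IsCMPair K S Sp) (s : S) :
    s ∈ Sp ∨ ∃ t ∈ Sp, conjGal K • t = s := by
  have : s ∈ Sp ∪ (fun s => conjGal K • s) '' Sp := by rw [hS.union_eq]; trivial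
  exact this

theorem IsCMPair.conj_smul_notMem (hS : IsCMPair K S Sp) {s : S} (hs : s ∈ Sp) :
    conjGal K • s ∉ Sp :=
  fun h => Set.disjoint_left.1 hS.disjoint h ⟨s, hs, rfl⟩

theorem IsCMPair.sum_eq (hS : IsCMPair K S Sp) [Fintype S] [Fintype Sp] {A : Type*}
    [AddCommMonoid A] (h : S → A) : ∑ s, h s = ∑ s : Sp, (h s + h (conjGal K • (s : S))) := by
  let f : Sp ⊕ Sp → S := Sum.elim Subtype.val fun s => conjGal K • (s : S)
  have hf : Function.Bijective f := by
    refine ⟨Function.Injective.sumElim Subtype.val_injective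
      (fun a b hab => Subtype.ext (smul_left_cancel _ hab))
      fun a b hab => hS.conj_smul_notMem b.2 (hab ▸ a.2), fun s => ?_⟩
    rcases hS.mem_or s with h | ⟨t, ht, rfl⟩
    · exact ⟨Sum.inl ⟨s, h⟩, rfl⟩
    · exact ⟨Sum.inr ⟨t, ht⟩, rfl⟩
  rw [← hf.sum_comp, Fintype.sum_sum_type, Finset.sum_add_distrib]
  rfl

theorem IsCMPair.card_eq (hS : IsCMPair K S Sp) [Fintype S] [Fintype Sp] :
    Fintype.card S = 2 * Fintype.card Sp := by
  have := hS.sum_eq (fun _ => 1)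
  simpa [mul_comm] using this

/-- The map `evalAt` as a `ℚ`-linear map. -/
def evalRat (K : Subfield ℂ) [NumberField K] [NumberField.IsCMField K] (S : Type*)
    [MulAction Gal(K/ℚ) S] (Sp : Set S) : equivariantMaps K S →ₗ[ℚ] (Sp → ℂ) where
  toFun e s := ((e : S → K) s : ℂ)
  map_add' a b := by ext; simp
  map_smul' q a := by ext; simp [Algebra.smul_def]

theorem evalRat_apply (e : equivariantMaps K S) (s : Sp) :
    evalRat K S Sp e s = ((e : S → K) s : ℂ) := rfl

theorem IsCMPair.evalRat_injective (hS : IsCMPair K S Sp) :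
    Function.Injective (evalRat K S Sp) := by
  rw [injective_iff_map_eq_zero]
  intro e he
  refine Subtype.ext (funext fun s => Subtype.ext ?_)
  rcases hS.mem_or s with h | ⟨t, ht, rfl⟩
  · exact congrFun he ⟨s, h⟩
  · rw [equivariantMaps_conj_smul]
    have : ((e : S → K) t : ℂ) = 0 := congrFun he ⟨t, ht⟩
    simp [this]

theorem span_periods {Λ : Submodule ℤ (equivariantMaps K S)} (hΛ : IsLattice K S Λ) :
    Submodule.span ℚ (periods K S Sp Λ : Set (Sp → ℂ)) = LinearMap.range (evalRat K S Sp) := by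
  have : (periods K S Sp Λ : Set (Sp → ℂ)) = evalRat K S Sp '' Λ := rfl
  rw [this, ← Submodule.map_span, hΛ.2, Submodule.map_top]

/-- A `ℚ`-basis of `E` is an `ℝ`-basis of `ℂ^{S⁺}`. -/
theorem IsCMPair.isBaseChange (hS : IsCMPair K S Sp) [IsGalois ℚ K] [Fintype S] [Fintype Sp] :
    IsBaseChange ℝ (evalRat K S Sp) := by
  let b := Module.finBasis ℚ (equivariantMaps K S)
  have hcard : Fintype.card (Fin (Module.finrank ℚ (equivariantMaps K S))) =
      Module.finrank ℝ (Sp → ℂ) := by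
    rw [Fintype.card_fin, finrank_equivariantMaps, hS.card_eq, Module.finrank_pi_fintype]
    simp [mul_comm]
  have hC : LinearIndependent ℂ fun i s => ((b i : S → K) s : ℂ) := by
    refine linearIndependent_of_top_le_span_of_card_eq_finrank
      (span_eq_top_of_basis K.subtype b).ge ?_
    rw [Fintype.card_fin, finrank_equivariantMaps, Module.finrank_fintype_fun_eq_card]
  have hR : LinearIndependent ℝ fun i => evalRat K S Sp (b i) := by
    rw [Fintype.linearIndependent_iff] at hC ⊢
    intro r hr i
    have h1 : ∀ s ∈ Sp, ∑ i, (r i : ℂ) * ((b i : S → K) s : ℂ) = 0 := fun s hs => by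
      simpa [evalRat_apply] using congrFun hr ⟨s, hs⟩
    have h2 := hC (fun i => (r i : ℂ)) (funext fun s => by
      simp only [Finset.sum_apply, Pi.smul_apply, smul_eq_mul, Pi.zero_apply]
      rcases hS.mem_or s with h | ⟨t, ht, rfl⟩
      · exact h1 s h
      · simp_rw [equivariantMaps_conj_smul]
        simpa using congrArg (starRingEnd ℂ) (h1 t ht)) i
    exact_mod_cast h2
  exact isBaseChange_of_basis _ b (basisOfLinearIndependentOfCardEqFinrank' _ hR hcard)
    fun i => by simp

theorem IsCMPair.span_real_periods (hS : IsCMPair K S Sp) [IsGalois ℚ K] [Fintype S] [Fintype Sp]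
    {Λ : Submodule ℤ (equivariantMaps K S)} (hΛ : IsLattice K S Λ) :
    Submodule.span ℝ (periods K S Sp Λ : Set (Sp → ℂ)) = ⊤ := by
  rw [← Submodule.span_span_of_tower ℚ ℝ, span_periods hΛ, eq_top_iff]
  let b := hS.isBaseChange.basis (Module.finBasis ℚ (equivariantMaps K S))
  rw [← b.span_eq]
  refine Submodule.span_mono ?_
  rintro _ ⟨i, rfl⟩
  exact ⟨_, (hS.isBaseChange.basis_apply _ i).symm⟩

/-- A totally imaginary element of `E` whose imaginary parts at `S⁺` are negative. It is found near
`(-i, …, -i)`, because `E` is dense in `ℂ^{S⁺}`. -/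
theorem IsCMPair.exists_imaginary (hS : IsCMPair K S Sp) [IsGalois ℚ K] [Fintype S] [Fintype Sp] :
    ∃ α : equivariantMaps K S, (∀ s, (((α : S → K) s : K) : ℂ).re = 0) ∧
      ∀ s ∈ Sp, (((α : S → K) s : K) : ℂ).im < 0 := by
  let b := Module.finBasis ℚ (equivariantMaps K S)
  let b' := hS.isBaseChange.basis b
  have hcont : Continuous fun r : Fin (Module.finrank ℚ (equivariantMaps K S)) → ℝ =>
      ∑ i, r i • b' i := by fun_prop
  have hopen : IsOpen {v : Sp → ℂ | ∀ s, (v s).im < 0} := by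
    simp only [Set.ofPred_forall]
    exact isOpen_iInter_of_finite fun s => isOpen_lt (by fun_prop) continuous_const
  have hdense : DenseRange (Pi.map fun (_ : Fin (Module.finrank ℚ (equivariantMaps K S))) =>
      ((↑) : ℚ → ℝ)) := DenseRange.piMap fun _ => Rat.denseRange_cast
  obtain ⟨q, hq⟩ := hdense.exists_mem_open (hopen.preimage hcont)
    ⟨fun i => b'.repr (fun _ => -Complex.I) i, by
      simp only [Set.mem_preimage, b'.sum_repr]
      intro s
      simp⟩
  let e : equivariantMaps K S := ∑ i, q i • b i
  have he : ∀ s : Sp, ((e : S → K) s : ℂ).im < 0 := by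
    have h1 : evalRat K S Sp e = ∑ i, (q i : ℝ) • b' i := by
      simp only [e, map_sum, map_smul, b', hS.isBaseChange.basis_apply]
      exact Finset.sum_congr rfl fun i _ => (Rat.cast_smul_eq_qsmul ℝ _ _).symm
    intro s
    rw [← evalRat_apply, h1]
    exact hq s
  refine ⟨⟨fun s => (e : S → K) s - (e : S → K) (conjGal K • s), fun g s => ?_⟩, fun s => ?_,
    fun s hs => ?_⟩
  · beta_reduce
    rw [← mul_smul, ← mul_conjGal, mul_smul, equivariantMaps_smul, equivariantMaps_smul e g,
      map_sub]
  · simp [equivariantMaps_conj_smul]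
  · have := he ⟨s, hs⟩
    simp only [Subfield.coe_sub, equivariantMaps_conj_smul, Complex.sub_im, Complex.conj_im]
    linarith

/-- For a totally imaginary `α` in `E` with negative imaginary parts at `S⁺`, a Riemann form is given
by `∑ α(s) u(s) conj(v(s))`, summed over `S`: on `E` its values are fixed by the Galois group, hence
rational. In terms of `S⁺` it is twice the real part of the sum over `S⁺`. -/
theorem IsCMPair.isAbelianVariety (hS : IsCMPair K S Sp) [IsGalois ℚ K] [Fintype S] [Fintype Sp]
    {Λ : Submodule ℤ (equivariantMaps K S)} (hΛ : IsLattice K S Λ) :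
    IsAbelianVariety (periods K S Sp Λ) := by
  obtain ⟨α, hre, him⟩ := hS.exists_imaginary
  let ψ : (Sp → ℂ) →ₗ[ℝ] (Sp → ℂ) →ₗ[ℝ] ℝ := LinearMap.mk₂ ℝ
    (fun u v => ∑ s : Sp, 2 * (((α : S → K) s : ℂ) * (u s * (starRingEnd ℂ) (v s))).re)
    (fun u u' v => by
      rw [← Finset.sum_add_distrib]
      exact Finset.sum_congr rfl fun s _ => by simp; ring)
    (fun c u v => by
      rw [smul_eq_mul, Finset.mul_sum]
      exact Finset.sum_congr rfl fun s _ => by simp; ring)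
    (fun u v v' => by
      rw [← Finset.sum_add_distrib]
      exact Finset.sum_congr rfl fun s _ => by simp; ring)
    (fun c u v => by
      rw [smul_eq_mul, Finset.mul_sum]
      exact Finset.sum_congr rfl fun s _ => by simp; ring)
  have hψ : ∀ u v, ψ u v =
      ∑ s : Sp, 2 * (((α : S → K) s : ℂ) * (u s * (starRingEnd ℂ) (v s))).re := fun u v => rfl
  refine isAbelianVariety_of_rational (hΛ.1.map _) (hS.span_real_periods hΛ) ψ ?_ ?_ ?_ ?_
  · intro u
    rw [hψ]
    exact Finset.sum_eq_zero fun s _ => by simp [Complex.mul_conj, hre]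
  · rintro _ ⟨e, -, rfl⟩ _ ⟨f, -, rfl⟩
    let x : S → K := fun s => (α : S → K) s * ((e : S → K) s * conjGal K ((f : S → K) s))
    have hx : ∀ (g : Gal(K/ℚ)) (s : S), x (g • s) = g (x s) := fun g s => by
      have h1 : conjGal K (g ((f : S → K) s)) = g (conjGal K ((f : S → K) s)) :=
        (DFunLike.congr_fun (mul_conjGal g) _).symm
      simp only [x, equivariantMaps_smul, map_mul, h1]
    obtain ⟨q, hq⟩ := exists_rat_of_forall_apply_eq (∑ s, x s) fun g => by
      rw [map_sum]
      simp_rw [← hx]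
      exact (MulAction.bijective g).sum_comp x
    refine ⟨q, ?_⟩
    have h2 : ((∑ s, x s : K) : ℂ) = ((ψ (evalAt K S Sp e) (evalAt K S Sp f) : ℝ) : ℂ) := by
      rw [hS.sum_eq, hψ]
      push_cast
      refine Finset.sum_congr rfl fun s _ => ?_
      rw [hx]
      have h3 : ∀ y : K, ((conjGal K y : K) : ℂ) = (starRingEnd ℂ) (y : ℂ) :=
        apply_conjGal K.subtype
      rw [h3, Complex.add_conj]
      simp only [x, Subfield.coe_mul, h3]
      push_cast
      rfl
    rw [hq] at h2
    exact_mod_cast h2.symm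
  · intro u v
    rw [hψ, hψ]
    refine Finset.sum_congr rfl fun s _ => ?_
    have : Complex.I * u s * (starRingEnd ℂ) (Complex.I * v s) = u s * (starRingEnd ℂ) (v s) := by
      rw [map_mul, Complex.conj_I]
      linear_combination (-u s * (starRingEnd ℂ) (v s)) * Complex.I_mul_I
    simp only [Pi.smul_apply, smul_eq_mul, this]
  · intro u hu
    rw [hψ]
    have hterm : ∀ s : Sp, 2 * (((α : S → K) s : ℂ) * ((Complex.I • u) s *
        (starRingEnd ℂ) (u s))).re = 2 * -((α : S → K) s : ℂ).im * Complex.normSq (u s) := by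
      intro s
      rw [Pi.smul_apply, smul_eq_mul, mul_assoc Complex.I, Complex.mul_conj]
      simp
      ring
    simp_rw [hterm]
    obtain ⟨s, hs⟩ := Function.ne_iff.1 hu
    refine Finset.sum_pos' (fun t _ => ?_) ⟨s, Finset.mem_univ _, ?_⟩
    · have := him t t.2
      exact mul_nonneg (by linarith) (Complex.normSq_nonneg _)
    · have := him s s.2
      exact mul_pos (by linarith) (Complex.normSq_pos.2 hs)

end CMPair

theorem bijective_algebraMap_matrix_one {L : Type*} [Field L] :
    Function.Bijective (algebraMap L (Matrix (Fin 1) (Fin 1) L)) := by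
  refine ⟨(algebraMap L (Matrix (Fin 1) (Fin 1) L)).injective, fun M => ⟨M 0 0, ?_⟩⟩
  ext i j
  simp [Matrix.algebraMap_matrix_apply, Subsingleton.elim i 0, Subsingleton.elim j 0]

/-! ### Endomorphisms of the torus of a pair -/

section PairEnd

open ComplexTorus

variable {K : Subfield ℂ} [NumberField K] [NumberField.IsCMField K]
  {S : Type*} [MulAction Gal(K/ℚ) S] {Sp : Set S}

/-- All lattices in `E` have the same rational span, so the identity of `ℂ^{S⁺}` is an isomorphism of
the rational structures. -/
theorem isogenous_periods [Fintype Sp] {Λ Λ' : Submodule ℤ (equivariantMaps K S)}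
    (hΛ : IsLattice K S Λ) (hΛ' : IsLattice K S Λ') :
    Isogenous (periods K S Sp Λ) (periods K S Sp Λ') := by
  refine isogenous_of_linear (hΛ.1.map _) (hΛ'.1.map _) (LinearEquiv.refl ℂ _) fun v => ?_
  rw [span_periods hΛ, span_periods hΛ']
  rfl

/-- The action of `E` on `ℂ^{S⁺}` by multiplication. -/
def mulHom (Sp : Set S) [Fintype Sp] {Λ : Submodule ℤ (equivariantMaps K S)}
    (hΛ : IsLattice K S Λ) :
    equivariantMaps K S →ₐ[ℚ] ratEnd (periods K S Sp Λ) where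
  toFun e := ⟨LinearMap.mulLeft ℂ (evalRat K S Sp e), fun v hv => by
    rw [span_periods hΛ] at hv ⊢
    obtain ⟨f, rfl⟩ := hv
    exact ⟨e * f, by ext; simp [evalRat_apply]⟩⟩
  map_one' := Subtype.ext <| LinearMap.ext fun v => by ext; simp [evalRat_apply]
  map_mul' e f := Subtype.ext <| LinearMap.ext fun v => by ext; simp [evalRat_apply, mul_assoc]
  map_zero' := Subtype.ext <| LinearMap.ext fun v => by ext; simp
  map_add' e f := Subtype.ext <| LinearMap.ext fun v => by ext; simp [evalRat_apply, add_mul]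
  commutes' q := Subtype.ext <| LinearMap.ext fun v => by
    ext s
    simp [evalRat_apply, Algebra.smul_def]

theorem mulHom_apply [Fintype Sp] {Λ : Submodule ℤ (equivariantMaps K S)} (hΛ : IsLattice K S Λ)
    (e : equivariantMaps K S) (v : Sp → ℂ) :
    (mulHom Sp hΛ e).1 v = evalRat K S Sp e * v := rfl

/-- A `ℂ`-linear endomorphism of `ℂ^{S⁺}` that preserves `E` is a multiplication, provided that
every `s` is determined by the set of all `g` with `g s ∈ S⁺`. Over `K`, the endomorphism is given
by an equivariant matrix indexed by `S`; its entry at `(s, t)` vanishes if `s ∈ S⁺` and `t ∉ S⁺`,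
hence also if this happens for `(g s, g t)` for some `g`. -/
theorem IsCMPair.exists_eq_mul (hS : IsCMPair K S Sp) [IsGalois ℚ K] [Fintype S] [Fintype Sp]
    (hsep : ∀ s t : S, (∀ g : Gal(K/ℚ), g • s ∈ Sp → g • t ∈ Sp) → s = t)
    (T : (Sp → ℂ) →ₗ[ℂ] (Sp → ℂ))
    (hT : ∀ e, T (evalRat K S Sp e) ∈ LinearMap.range (evalRat K S Sp)) :
    ∃ α : equivariantMaps K S, ∀ v, T v = evalRat K S Sp α * v := by
  classical
  let R : equivariantMaps K S →ₗ[ℚ] equivariantMaps K S :=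
    (LinearEquiv.ofInjective _ hS.evalRat_injective).symm.toLinearMap ∘ₗ
      ((T.restrictScalars ℚ) ∘ₗ evalRat K S Sp).codRestrict _ hT
  have hR : ∀ e, evalRat K S Sp (R e) = T (evalRat K S Sp e) := fun e =>
    congrArg Subtype.val ((LinearEquiv.ofInjective _ hS.evalRat_injective).apply_symm_apply
      ⟨T (evalRat K S Sp e), hT e⟩)
  let A : (S → K) →ₗ[K] (S → K) :=
    isBaseChange_val.lift ((equivariantMaps K S).val.toLinearMap ∘ₗ R)
  let τ : S → S → K := fun s t => A (Pi.single t 1) s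
  have hτ : ∀ e s, ((R e : equivariantMaps K S) : S → K) s = ∑ t, τ s t * (e : S → K) t := by
    intro e s
    have h1 : A (e : S → K) = (R e : S → K) := isBaseChange_val.lift_eq _ e
    rw [← h1, map_eq_sum_single A (e : S → K), Finset.sum_apply]
    exact Finset.sum_congr rfl fun t _ => mul_comm _ _
  have hequiv : ∀ (g : Gal(K/ℚ)) (s t : S), τ (g • s) (g • t) = g (τ s t) := by
    intro g s t
    have h1 := eq_zero_of_sum_mul_eq_zero (RingHom.id K)
      (fun t => τ (g • s) t - g (τ s (g⁻¹ • t))) fun e => by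
        have h2 : ∑ t, g (τ s (g⁻¹ • t)) * (e : S → K) t = ∑ t, g (τ s t * (e : S → K) t) := by
          refine (Fintype.sum_bijective (g • ·) (MulAction.bijective g) _ _ fun t => ?_).symm
          rw [inv_smul_smul, map_mul, equivariantMaps_smul]
        simp only [RingHom.id_apply, sub_mul, Finset.sum_sub_distrib]
        rw [h2, ← map_sum, ← hτ, ← hτ, equivariantMaps_smul, sub_self]
    have h3 := congrFun h1 (g • t)
    simp only [inv_smul_smul, Pi.zero_apply, sub_eq_zero] at h3
    exact h3
  have hzero : ∀ s ∈ Sp, ∀ t ∉ Sp, τ s t = 0 := by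
    intro s hs t ht
    have h1 := eq_zero_of_sum_mul_eq_zero K.subtype
      (fun t => (τ s t : ℂ) - if h : t ∈ Sp then T (Pi.single ⟨t, h⟩ 1) ⟨s, hs⟩ else 0) fun e => by
        have h2 := congrFun (hR e) ⟨s, hs⟩
        rw [evalRat_apply, hτ, map_eq_sum_single T, Finset.sum_apply] at h2
        simp only [sub_mul, Finset.sum_sub_distrib, sub_eq_zero]
        have h3 : ∑ t, (τ s t : ℂ) * K.subtype ((e : S → K) t) =
            ((∑ t, τ s t * (e : S → K) t : K) : ℂ) := by push_cast; rfl
        rw [h3, h2, hS.sum_eq]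
        refine Finset.sum_congr rfl fun t _ => ?_
        rw [dif_pos t.2, dif_neg (hS.conj_smul_notMem t.2), zero_mul, add_zero, Pi.smul_apply,
          smul_eq_mul, mul_comm]
        rfl
    have h4 := congrFun h1 t
    simp only [dif_neg ht, sub_zero, Pi.zero_apply] at h4
    exact_mod_cast h4
  have hdiag : ∀ s t, s ≠ t → τ s t = 0 := by
    intro s t hst
    by_contra h0
    refine hst (hsep s t fun g hg => ?_)
    by_contra hgt
    refine h0 (g.injective ?_)
    rw [← hequiv, hzero _ hg _ hgt, map_zero]
  refine ⟨⟨fun s => τ s s, fun g s => hequiv g s s⟩, ?_⟩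
  have hlin : (T.restrictScalars ℝ) =
      (LinearMap.mulLeft ℂ (fun s : Sp => (τ s s : ℂ))).restrictScalars ℝ := by
    refine hS.isBaseChange.algHom_ext _ _ fun e => ?_
    funext s
    change T (evalRat K S Sp e) s = (τ s s : ℂ) * ((e : S → K) s : ℂ)
    rw [← hR, evalRat_apply, hτ, Finset.sum_eq_single (s : S)
      (fun t _ hts => by rw [hdiag _ _ hts.symm, zero_mul]) (by simp)]
    rfl
  exact fun v => LinearMap.congr_fun hlin v

theorem IsCMPair.mulHom_bijective (hS : IsCMPair K S Sp) [IsGalois ℚ K] [Fintype S] [Fintype Sp]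
    (hsep : ∀ s t : S, (∀ g : Gal(K/ℚ), g • s ∈ Sp → g • t ∈ Sp) → s = t)
    {Λ : Submodule ℤ (equivariantMaps K S)} (hΛ : IsLattice K S Λ) :
    Function.Bijective (mulHom Sp hΛ) := by
  constructor
  · intro e f hef
    have h := LinearMap.congr_fun (congrArg Subtype.val hef) 1
    rw [mulHom_apply, mulHom_apply, mul_one, mul_one] at h
    exact hS.evalRat_injective h
  · intro T
    obtain ⟨α, hα⟩ := hS.exists_eq_mul hsep T.1 fun e => by
      rw [← span_periods hΛ]
      exact T.2 _ (by rw [span_periods hΛ]; exact ⟨e, rfl⟩)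
    exact ⟨α, Subtype.ext (LinearMap.ext fun v => (hα v).symm)⟩

/-- `End⁰(A(S, S⁺)) = E`, provided that every `s` is determined by the set of all `g` with
`g s ∈ S⁺`. -/
def IsCMPair.endZeroEquivariantMaps (hS : IsCMPair K S Sp) [IsGalois ℚ K] [Fintype S] [Fintype Sp]
    (hsep : ∀ s t : S, (∀ g : Gal(K/ℚ), g • s ∈ Sp → g • t ∈ Sp) → s = t)
    {Λ : Submodule ℤ (equivariantMaps K S)} (hΛ : IsLattice K S Λ) :
    EndZero (periods K S Sp Λ) ≃ₐ[ℚ] equivariantMaps K S :=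
  have := (hS.isAbelianVariety hΛ).discrete
  (endZeroEquiv (periods K S Sp Λ) (hΛ.1.map _)).trans
    (AlgEquiv.ofBijective _ (hS.mulHom_bijective hsep hΛ)).symm

theorem IsCMPair.isCM (hS : IsCMPair K S Sp) [IsGalois ℚ K] [Fintype S] [Fintype Sp]
    (hsep : ∀ s t : S, (∀ g : Gal(K/ℚ), g • s ∈ Sp → g • t ∈ Sp) → s = t)
    {Λ : Submodule ℤ (equivariantMaps K S)} (hΛ : IsLattice K S Λ) :
    IsCM (periods K S Sp Λ) := by
  refine ⟨equivariantMaps K S, inferInstance, inferInstance,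
    (hS.endZeroEquivariantMaps hsep hΛ).symm.toAlgHom, etale_equivariantMaps,
    (hS.endZeroEquivariantMaps hsep hΛ).symm.injective, ?_⟩
  rw [finrank_equivariantMaps, hS.card_eq, Module.finrank_fintype_fun_eq_card]

theorem IsCMPair.isSplitBy (hS : IsCMPair K S Sp) [IsGalois ℚ K] [Fintype S] [Fintype Sp]
    (hsep : ∀ s t : S, (∀ g : Gal(K/ℚ), g • s ∈ Sp → g • t ∈ Sp) → s = t)
    {Λ : Submodule ℤ (equivariantMaps K S)} (hΛ : IsLattice K S Λ) :
    IsSplitBy K (periods K S Sp Λ) := by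
  refine ⟨Fintype.card S, fun _ => 1, ⟨?_⟩⟩
  refine (Algebra.TensorProduct.congr AlgEquiv.refl (hS.endZeroEquivariantMaps hsep hΛ)).trans ?_
  refine (tensorEquivariantMapsEquiv K S).trans ?_
  refine (AlgEquiv.piCongrLeft K (fun _ => K) (Fintype.equivFin S)).trans ?_
  exact AlgEquiv.piCongrRight fun _ =>
    AlgEquiv.ofBijective (Algebra.ofId K (Matrix (Fin 1) (Fin 1) K)) bijective_algebraMap_matrix_one

end PairEnd

/-! ### CM-types -/

section CMTypes

variable {K : Subfield ℂ} [NumberField K] [NumberField.IsCMField K]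

theorem CMType.mem_smul_iff (Φ : CMType K) (g h : Gal(K/ℚ)) : h ∈ (g • Φ).1 ↔ h * g ∈ Φ.1 := by
  change h ∈ (fun φ => φ * g⁻¹) '' Φ.1 ↔ _
  constructor
  · rintro ⟨φ, hφ, rfl⟩
    simpa using hφ
  · exact fun hh => ⟨_, hh, by simp⟩

theorem CMType.smul_mem_plus_iff (Φ : CMType K) (g : Gal(K/ℚ)) :
    g • Φ ∈ CMType.plus K ↔ g ∈ Φ.1 := by
  change 1 ∈ (g • Φ).1 ↔ _
  rw [CMType.mem_smul_iff, one_mul]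

theorem conjGal_mul_self : conjGal K * conjGal K = 1 := by
  ext x
  have h : ∀ y : K, ((conjGal K y : K) : ℂ) = (starRingEnd ℂ) (y : ℂ) := apply_conjGal K.subtype
  simp [h]

theorem CMType.conj_mul_mem_iff (Φ : CMType K) (g : Gal(K/ℚ)) :
    conjGal K * g ∈ Φ.1 ↔ g ∉ Φ.1 := by
  constructor
  · intro h hg
    exact Set.disjoint_left.1 Φ.2.1 h ⟨g, hg, rfl⟩
  · intro h
    have : g ∈ Φ.1 ∪ (fun φ => conjGal K * φ) '' Φ.1 := by rw [Φ.2.2]; trivial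
    rcases this with h' | ⟨φ, hφ, rfl⟩
    · exact absurd h' h
    · rw [← mul_assoc, conjGal_mul_self, one_mul]
      exact hφ

theorem CMType.conj_smul_mem_plus_iff (Φ : CMType K) :
    conjGal K • Φ ∈ CMType.plus K ↔ Φ ∉ CMType.plus K := by
  rw [CMType.smul_mem_plus_iff]
  have := Φ.conj_mul_mem_iff 1
  rwa [mul_one] at this

theorem isCMPair_cmType : IsCMPair K (CMType K) (CMType.plus K) where
  finite := inferInstance
  conj_smul_ne Φ h := by
    have := Φ.conj_smul_mem_plus_iff
    rw [h] at this
    tauto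
  disjoint := by
    rw [Set.disjoint_left]
    rintro _ h ⟨Φ, hΦ, rfl⟩
    exact Φ.conj_smul_mem_plus_iff.1 h hΦ
  union_eq := by
    refine Set.eq_univ_of_forall fun Φ => ?_
    by_cases h : Φ ∈ CMType.plus K
    · exact Or.inl h
    · exact Or.inr ⟨conjGal K • Φ, Φ.conj_smul_mem_plus_iff.2 h, by
        change conjGal K • conjGal K • Φ = Φ
        rw [← mul_smul, conjGal_mul_self, one_smul]⟩

/-- As `g Φ` contains `1` if and only if `Φ` contains `g`, a CM-type is determined by its orbit
relative to `CMType.plus`. -/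
theorem CMType.eq_of_forall_smul_mem_plus (Φ Ψ : CMType K)
    (h : ∀ g : Gal(K/ℚ), g • Φ ∈ CMType.plus K → g • Ψ ∈ CMType.plus K) : Φ = Ψ := by
  simp only [CMType.smul_mem_plus_iff] at h
  refine Subtype.ext (Set.Subset.antisymm h fun g hg => ?_)
  by_contra hΦ
  exact (Ψ.conj_mul_mem_iff g).1 (h _ ((Φ.conj_mul_mem_iff g).2 hΦ)) hg

end CMTypes

/-! ### Simple CM abelian varieties -/

namespace ComplexTorus

variable {V : Type u} [NormedAddCommGroup V] [NormedSpace ℂ V]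
variable {W : Type v} [NormedAddCommGroup W] [NormedSpace ℂ W] [Module ℚ W]

theorem mem_span_real_inter {M : Submodule ℤ W} (U : Submodule ℂ W) {u : W} (hu : u ∈ U)
    (hu' : u ∈ Submodule.span ℚ (M : Set W)) : u ∈ Submodule.span ℝ ((U : Set W) ∩ M) := by
  obtain ⟨n, hn, h⟩ := (mem_span_rat_iff _ _).1 hu'
  have hn' : (n : ℝ) ≠ 0 := by exact_mod_cast hn
  have h1 : u = (n : ℝ)⁻¹ • n • u := by
    rw [← Int.cast_smul_eq_zsmul ℝ, smul_smul, inv_mul_cancel₀ hn', one_smul]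
  rw [h1]
  exact Submodule.smul_mem _ _ (Submodule.subset_span ⟨zsmul_mem hu n, h⟩)

/-- The image of a linear map that is defined over `ℚ` is an abelian subvariety. -/
theorem IsSimple.range_eq {M : Submodule ℤ W} (hs : IsSimple M) {L : Submodule ℤ V}
    (hL : Submodule.span ℝ (L : Set V) = ⊤) (T : V →ₗ[ℂ] W)
    (hT : ∀ v ∈ L, T v ∈ Submodule.span ℚ (M : Set W)) : T = 0 ∨ LinearMap.range T = ⊤ := by
  have h := hs.2 (LinearMap.range T) (le_antisymm
    (Submodule.span_le.2 fun w hw => hw.1) fun w hw => by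
      obtain ⟨v, rfl⟩ := hw
      have hv : v ∈ Submodule.span ℝ (L : Set V) := by rw [hL]; trivial
      induction hv using Submodule.span_induction with
      | mem x hx => exact mem_span_real_inter _ ⟨x, rfl⟩ (hT x hx)
      | zero => simp
      | add x y _ _ hx hy => rw [map_add]; exact Submodule.add_mem _ hx hy
      | smul r x _ hx =>
        have : T (r • x) = r • T x := (T.restrictScalars ℝ).map_smul r x
        rw [this]
        exact Submodule.smul_mem _ _ hx)
  rwa [LinearMap.range_eq_bot] at h

theorem IsSimple.injective_of_mem_ratEnd [FiniteDimensional ℂ W] {M : Submodule ℤ W}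
    (hM : IsAbelianVariety M) (hs : IsSimple M) {T : Module.End ℂ W} (hT : T ∈ ratEnd M)
    (h0 : T ≠ 0) : Function.Injective T := by
  rcases hs.range_eq hM.span_eq_top T fun v hv => hT v (Submodule.subset_span hv) with h | h
  · exact absurd h h0
  · exact LinearMap.injective_iff_surjective.2 (LinearMap.range_eq_top.1 h)

/-- The map `x ↦ x m` for an action `θ` of an algebra on the tangent space. -/
def orbitMap {F : Type*} [Ring F] [Algebra ℚ F] (θ : F →ₐ[ℚ] Module.End ℂ W) (m : W) :
    F →ₗ[ℚ] W where
  toFun x := θ x m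
  map_add' x y := by simp
  map_smul' q x := by simp

theorem orbitMap_apply {F : Type*} [Ring F] [Algebra ℚ F] (θ : F →ₐ[ℚ] Module.End ℂ W) (m : W)
    (x : F) : orbitMap θ m x = θ x m := rfl

/-- If `K ⊗ F` is a product of matrix algebras over `K` for a field `F`, then `F` embeds in `K`:
a diagonal entry of the matrices is multiplicative on a commutative algebra that contains the
matrix units. -/
theorem nonempty_algHom_of_split {K F : Type*} [Field K] [CharZero K] [Field F] [Algebra ℚ F]
    {n : ℕ} {d : Fin n → ℕ}
    (e : K ⊗[ℚ] F ≃ₐ[K] ((j : Fin n) → Matrix (Fin (d j)) (Fin (d j)) K)) :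
    Nonempty (F →ₐ[ℚ] K) := by
  have hj : ∃ j, d j ≠ 0 := by
    by_contra! h
    have : ∀ j, Subsingleton (Matrix (Fin (d j)) (Fin (d j)) K) := fun j => by
      rw [h j]; infer_instance
    exact not_subsingleton (K ⊗[ℚ] F) e.toEquiv.subsingleton
  obtain ⟨j, hj⟩ := hj
  have : NeZero (d j) := ⟨hj⟩
  let i : Fin (d j) := 0
  have hcomm : ∀ (x : K ⊗[ℚ] F) (N : Matrix (Fin (d j)) (Fin (d j)) K), e x j * N = N * e x j := by
    intro x N
    have h1 := congrArg e (mul_comm x (e.symm (Pi.single j N)))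
    rw [map_mul, map_mul, e.apply_symm_apply] at h1
    simpa using congrFun h1 j
  have hoff : ∀ (x : K ⊗[ℚ] F) (k : Fin (d j)), k ≠ i → e x j i k = 0 := by
    intro x k hk
    have h1 := congrFun (congrFun (hcomm x (Matrix.single i i 1)) i) k
    rw [Matrix.mul_single_apply_of_ne _ _ _ _ _ hk, Matrix.single_mul_apply_same, one_mul] at h1
    exact h1.symm
  let f : K ⊗[ℚ] F →ₐ[K] K :=
    { toFun := fun x => e x j i i
      map_one' := by simp
      map_mul' := fun x y => by
        rw [map_mul, Pi.mul_apply, Matrix.mul_apply, Finset.sum_eq_single i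
          (fun k _ hk => by rw [hoff x k hk, zero_mul]) (by simp)]
      map_zero' := by simp
      map_add' := fun x y => by simp
      commutes' := fun c => by
        rw [e.commutes, Pi.algebraMap_apply, Matrix.algebraMap_matrix_apply, if_pos rfl] }
  exact ⟨(f.restrictScalars ℚ).comp Algebra.TensorProduct.includeRight⟩

/-- The endomorphism algebra of a simple CM abelian variety is a field `F` of degree `2 dim`, and
the rational span of the lattice is a line over `F`: a nonzero rational vector gives an injection of
`End⁰` into the rational span, so that there is no room in `End⁰` outside the given étale
subalgebra. If the variety is split by `K`, then `F` embeds in `K`. -/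
theorem IsSimple.exists_field [FiniteDimensional ℂ W] {M : Submodule ℤ W}
    (hM : IsAbelianVariety M) (hs : IsSimple M) (hcm : IsCM M) (K : Type*) [Field K] [CharZero K]
    (hK : IsSplitBy K M) :
    ∃ (F : Type v) (_ : Field F) (_ : Algebra ℚ F) (_ : FiniteDimensional ℚ F)
      (θ : F →ₐ[ℚ] Module.End ℂ W) (m : W),
      IsBaseChange ℝ (orbitMap θ m) ∧
      LinearMap.range (orbitMap θ m) = Submodule.span ℚ (M : Set W) ∧ Nonempty (F →ₐ[ℚ] K) := by
  have := hM.discrete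
  have := hs.1
  have : FiniteDimensional ℝ W := FiniteDimensional.complexToReal W
  let P := Submodule.span ℚ (M : Set W)
  have hP : IsBaseChange ℝ P.subtype := hM.isBaseChange
  have hPfin : FiniteDimensional ℚ P := by
    obtain ⟨s, hs'⟩ := hM.fg
    refine Module.Finite.iff_fg.2 ⟨s, ?_⟩
    change _ = Submodule.span ℚ (M : Set W)
    rw [← hs', Submodule.span_span_of_tower]
  have hPrank : Module.finrank ℚ P = 2 * Module.finrank ℂ W := by
    rw [← finrank_real_of_complex W]
    have h1 := Module.finrank_eq_card_basis (hP.basis (Module.finBasis ℚ P))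
    simpa using h1.symm
  obtain ⟨m, hmM, hm0⟩ : ∃ m ∈ M, m ≠ 0 := by
    by_contra! h
    have h1 : (M : Set W) ⊆ {0} := fun m hm => h m hm
    have h2 := hM.span_eq_top
    have h3 : Submodule.span ℝ (M : Set W) ≤ ⊥ := Submodule.span_le.2 h1
    rw [h2] at h3
    exact bot_ne_top (le_antisymm bot_le h3)
  have hmP : m ∈ P := Submodule.subset_span hmM
  have hinj : ∀ T ∈ ratEnd M, T m = 0 → T = 0 := fun T hT h => by
    by_contra h0
    exact hm0 (hs.injective_of_mem_ratEnd hM hT h0 (by rw [h, map_zero]))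
  let ev : ratEnd M →ₗ[ℚ] P :=
    { toFun := fun T => ⟨T.1 m, T.2 m hmP⟩
      map_add' := fun S T => Subtype.ext rfl
      map_smul' := fun q T => Subtype.ext rfl }
  have hev : Function.Injective ev := by
    rw [injective_iff_map_eq_zero]
    exact fun T hT => Subtype.ext (hinj T.1 T.2 (congrArg Subtype.val hT))
  have hDfin : FiniteDimensional ℚ (ratEnd M) := FiniteDimensional.of_injective ev hev
  obtain ⟨F, _, _, i, -, hi, hF⟩ := hcm
  let θ' : F →ₐ[ℚ] ratEnd M := (endZeroEquiv M hM.fg).toAlgHom.comp i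
  have hθ' : Function.Injective θ' := (endZeroEquiv M hM.fg).injective.comp hi
  have hFfin : FiniteDimensional ℚ F :=
    FiniteDimensional.of_injective θ'.toLinearMap hθ'
  have hrank : Module.finrank ℚ F = Module.finrank ℚ (ratEnd M) := by
    refine le_antisymm (LinearMap.finrank_le_finrank_of_injective (f := θ'.toLinearMap) hθ') ?_
    rw [hF, ← hPrank]
    exact LinearMap.finrank_le_finrank_of_injective hev
  have hsurj : Function.Surjective θ' :=
    (LinearMap.injective_iff_surjective_of_finrank_eq_finrank (f := θ'.toLinearMap) hrank).1 hθ'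
  have hdom : IsDomain F := by
    have hnt : Nontrivial F := by
      refine ⟨1, 0, fun h => hm0 ?_⟩
      have h1 := congrArg θ' h
      rw [map_one, map_zero] at h1
      exact LinearMap.congr_fun (congrArg Subtype.val h1) m
    have hnz : NoZeroDivisors F := by
      refine ⟨fun {x y} hxy => ?_⟩
      by_contra! h
      have hx : (θ' x).1 ≠ 0 := fun h0 => h.1 (hθ' (by rw [map_zero]; exact Subtype.ext h0))
      refine h.2 (hθ' (by
        rw [map_zero]
        refine Subtype.ext (LinearMap.ext fun w => ?_)
        refine hs.injective_of_mem_ratEnd hM (θ' x).2 hx ?_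
        have h1 := congrArg θ' hxy
        rw [map_mul, map_zero] at h1
        refine (LinearMap.congr_fun (congrArg Subtype.val h1) w).trans ?_
        exact (map_zero (θ' x).1).symm))
    exact NoZeroDivisors.to_isDomain F
  let _ : Field F := fieldOfFiniteDimensional ℚ F
  let θ : F →ₐ[ℚ] Module.End ℂ W := (ratEnd M).val.comp θ'
  have hθP : ∀ x, orbitMap θ m x ∈ P := fun x => (θ' x).2 m hmP
  have hθinj : Function.Injective (orbitMap θ m) := by
    rw [injective_iff_map_eq_zero]
    exact fun x hx => (map_eq_zero_iff θ' hθ').1 (Subtype.ext (hinj _ (θ' x).2 hx))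
  have hrange : LinearMap.range (orbitMap θ m) = P := by
    refine Submodule.eq_of_le_of_finrank_eq ?_ ?_
    · rintro _ ⟨x, rfl⟩
      exact hθP x
    · rw [LinearMap.finrank_range_of_inj hθinj, hF, hPrank]
  refine ⟨F, inferInstance, inferInstance, hFfin, θ, m, ?_, hrange, ?_⟩
  · let e : F ≃ₗ[ℚ] P := (LinearEquiv.ofInjective _ hθinj).trans (LinearEquiv.ofEq _ _ hrange)
    exact hP.comp_equiv e
  · obtain ⟨n, d, ⟨f⟩⟩ := hK
    let e : F ≃ₐ[ℚ] EndZero M := (AlgEquiv.ofBijective θ' ⟨hθ', hsurj⟩).trans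
      (endZeroEquiv M hM.fg).symm
    exact nonempty_algHom_of_split ((Algebra.TensorProduct.congr AlgEquiv.refl e).trans f)

end ComplexTorus

/-! ### The characters of a CM field on the tangent space -/

namespace ComplexTorus

section Characters

variable {W : Type v} [NormedAddCommGroup W] [NormedSpace ℂ W] [Module ℚ W]
variable {F : Type w} [Field F] [Algebra ℚ F] {θ : F →ₐ[ℚ] Module.End ℂ W} {m : W}

/-- The `ℝ`-linear form on the tangent space that extends `x m ↦ σ x`. -/
def character (hm : IsBaseChange ℝ (orbitMap θ m)) (σ : F →ₐ[ℚ] ℂ) : W →ₗ[ℝ] ℂ :=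
  hm.lift σ.toLinearMap

theorem character_orbitMap (hm : IsBaseChange ℝ (orbitMap θ m)) (σ : F →ₐ[ℚ] ℂ) (x : F) :
    character hm σ (θ x m) = σ x :=
  hm.lift_eq _ x

theorem character_action (hm : IsBaseChange ℝ (orbitMap θ m)) (σ : F →ₐ[ℚ] ℂ) (x : F) (w : W) :
    character hm σ (θ x w) = σ x * character hm σ w := by
  have h : character hm σ ∘ₗ ((θ x).restrictScalars ℝ) =
      (LinearMap.mulLeft ℝ (σ x)) ∘ₗ character hm σ :=
    hm.algHom_ext _ _ fun y => by
      change character hm σ (θ x (θ y m)) = σ x * character hm σ (θ y m)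
      rw [← Module.End.mul_apply, ← map_mul, character_orbitMap, character_orbitMap, map_mul]
  exact LinearMap.congr_fun h w

/-- The form `character hm σ` is either `ℂ`-linear or conjugate-linear, because the complex structure
commutes with `F`; the value at `i m` decides which, see `character_I_smul_eq_or`. -/
theorem character_I_smul (hm : IsBaseChange ℝ (orbitMap θ m)) (σ : F →ₐ[ℚ] ℂ) (w : W) :
    character hm σ (Complex.I • w) = character hm σ (Complex.I • m) * character hm σ w := by
  have h : character hm σ ∘ₗ ((Complex.I • (LinearMap.id : W →ₗ[ℂ] W)).restrictScalars ℝ) =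
      (LinearMap.mulLeft ℝ (character hm σ (Complex.I • m))) ∘ₗ character hm σ :=
    hm.algHom_ext _ _ fun y => by
      change character hm σ (Complex.I • θ y m) =
        character hm σ (Complex.I • m) * character hm σ (θ y m)
      rw [← map_smul, character_action, character_orbitMap, mul_comm]
  exact LinearMap.congr_fun h w

theorem character_I_smul_eq_or (hm : IsBaseChange ℝ (orbitMap θ m)) (σ : F →ₐ[ℚ] ℂ) :
    character hm σ (Complex.I • m) = Complex.I ∨ character hm σ (Complex.I • m) = -Complex.I := by
  rw [← sq_eq_sq_iff_eq_or_eq_neg, sq, ← character_I_smul, smul_smul, Complex.I_mul_I, Complex.I_sq,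
    neg_one_smul, map_neg]
  have h := character_orbitMap hm σ 1
  rw [map_one, map_one] at h
  rw [← h]
  rfl

theorem character_conj (hm : IsBaseChange ℝ (orbitMap θ m)) (σ σ' : F →ₐ[ℚ] ℂ)
    (h : ∀ x, σ' x = (starRingEnd ℂ) (σ x)) (w : W) :
    character hm σ' w = (starRingEnd ℂ) (character hm σ w) := by
  have h' : character hm σ' = Complex.conjAe.toLinearMap ∘ₗ character hm σ :=
    hm.algHom_ext _ _ fun y => by
      change character hm σ' (θ y m) = (starRingEnd ℂ) (character hm σ (θ y m))
      rw [character_orbitMap, character_orbitMap, h]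
  exact LinearMap.congr_fun h' w

/-- The matrix of the values of the embeddings of `F` at a basis is invertible. -/
theorem eq_zero_of_forall_character_eq_zero [FiniteDimensional ℚ F]
    (hm : IsBaseChange ℝ (orbitMap θ m)) (w : W) (h : ∀ σ, character hm σ w = 0) : w = 0 := by
  let b := Module.finBasis ℚ F
  let b' := hm.basis b
  let e : Fin (Module.finrank ℚ F) ≃ (F →ₐ[ℚ] ℂ) :=
    Fintype.equivOfCardEq (by rw [Fintype.card_fin, AlgHom.card])
  have hdet : (Algebra.embeddingsMatrixReindex ℚ ℂ b e).det ≠ 0 := fun h0 => by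
    have h1 := Algebra.discr_eq_det_embeddingsMatrixReindex_pow_two ℚ ℂ b e
    rw [h0, zero_pow two_ne_zero, map_eq_zero] at h1
    exact Algebra.discr_not_zero_of_basis ℚ b h1
  have h2 := Matrix.eq_zero_of_vecMul_eq_zero hdet (v := fun i => (b'.repr w i : ℂ)) (by
    funext j
    have h3 := h (e j)
    rw [← b'.sum_repr w, map_sum] at h3
    simp only [map_smul, b', hm.basis_apply, orbitMap_apply, character_orbitMap,
      Complex.real_smul] at h3
    exact h3)
  refine b'.ext_elem fun i => ?_
  simpa using congrFun h2 i

/-- The embeddings of `F` in `ℂ` obtained from an embedding `ρ` in `K`. -/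
def embed {K : Subfield ℂ} [NumberField K] (ρ : F →ₐ[ℚ] K) (g : Gal(K/ℚ)) : F →ₐ[ℚ] ℂ :=
  (IsScalarTower.toAlgHom ℚ K ℂ).comp (g.toAlgHom.comp ρ)

theorem embed_apply {K : Subfield ℂ} [NumberField K] (ρ : F →ₐ[ℚ] K) (g : Gal(K/ℚ)) (x : F) :
    embed ρ g x = (g (ρ x) : ℂ) := rfl

/-- As `K` is normal, every embedding of `F` in `ℂ` arises from `ρ`. -/
theorem exists_eq_embed {K : Subfield ℂ} [NumberField K] [IsGalois ℚ K] (ρ : F →ₐ[ℚ] K)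
    (σ : F →ₐ[ℚ] ℂ) : ∃ g, σ = embed ρ g := by
  let _ : Algebra F K := ρ.toRingHom.toAlgebra
  let _ : Algebra F ℂ := σ.toRingHom.toAlgebra
  have : IsScalarTower ℚ F K := IsScalarTower.of_algebraMap_eq fun q => (ρ.commutes q).symm
  have : IsScalarTower ℚ F ℂ := IsScalarTower.of_algebraMap_eq fun q => (σ.commutes q).symm
  have : Algebra.IsAlgebraic F K := Algebra.IsAlgebraic.tower_top (K := ℚ) F
  let τ : K →ₐ[F] ℂ := IsAlgClosed.lift
  refine ⟨Normal.algHomEquivAut ℚ ℂ K (τ.restrictScalars ℚ), AlgHom.ext fun x => ?_⟩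
  have h1 := DFunLike.congr_fun ((Normal.algHomEquivAut ℚ ℂ K).symm_apply_apply
    (τ.restrictScalars ℚ)) (ρ x)
  exact (τ.commutes x).symm.trans h1.symm

end Characters

end ComplexTorus

/-! ### Isogeny factors of the torus of a pair -/

section Factor

open ComplexTorus

/-- If the stabilizer of `s₀` contains all `g` that fix `ρ(F)`, then `ρ(F)` contains the values at
`s₀` of equivariant maps. -/
theorem exists_valueHom {K : Subfield ℂ} [NumberField K] [IsGalois ℚ K] {S : Type u}
    [MulAction Gal(K/ℚ) S] {F : Type w} [Field F] [Algebra ℚ F] {s₀ : S} {ρ : F →ₐ[ℚ] K}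
    (hfix : ∀ g : Gal(K/ℚ), (∀ x, g (ρ x) = ρ x) → g • s₀ = s₀) :
    ∃ f : equivariantMaps K S →ₐ[ℚ] F, ∀ e, ρ (f e) = (e : S → K) s₀ := by
  let ev : equivariantMaps K S →ₐ[ℚ] K :=
    (Pi.evalAlgHom ℚ (fun _ : S => K) s₀).comp (equivariantMaps K S).val
  have hev : ∀ e, ev e ∈ ρ.range := by
    intro e
    have h1 : ev e ∈ ρ.fieldRange := by
      rw [← IsGalois.fixedField_fixingSubgroup ρ.fieldRange, IntermediateField.mem_fixedField_iff]
      intro g hg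
      have h2 := hfix g fun x => (IntermediateField.mem_fixingSubgroup_iff _ _).1 hg _ ⟨x, rfl⟩
      change g ((e : S → K) s₀) = (e : S → K) s₀
      rw [← equivariantMaps_smul, h2]
    exact h1
  refine ⟨(AlgEquiv.ofInjectiveField ρ).symm.toAlgHom.comp (ev.codRestrict ρ.range hev),
    fun e => ?_⟩
  exact congrArg Subtype.val ((AlgEquiv.ofInjectiveField ρ).apply_symm_apply ⟨ev e, hev e⟩)

variable {K : Subfield ℂ} [NumberField K] [NumberField.IsCMField K]
  {S : Type u} [MulAction Gal(K/ℚ) S] {Sp : Set S}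
  {W : Type v} [NormedAddCommGroup W] [NormedSpace ℂ W] [Module ℚ W]
  {F : Type w} [Field F] [Algebra ℚ F] {θ : F →ₐ[ℚ] Module.End ℂ W} {m : W}

/-- The indicator function of an orbit. -/
def orbitIndicator (K : Subfield ℂ) {S : Type u} [MulAction Gal(K/ℚ) S] (s₀ : S) :
    equivariantMaps K S :=
  open Classical in
  ⟨fun s => if s ∈ MulAction.orbit Gal(K/ℚ) s₀ then 1 else 0, fun g s => by
    have h : g • s ∈ MulAction.orbit Gal(K/ℚ) s₀ ↔ s ∈ MulAction.orbit Gal(K/ℚ) s₀ := by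
      rw [← MulAction.orbit_eq_iff, MulAction.orbit_smul, MulAction.orbit_eq_iff]
    by_cases hs : s ∈ MulAction.orbit Gal(K/ℚ) s₀ <;> simp [h, hs]⟩

/-- The extension of the rational map `e ↦ x m`, where `ρ x = e s₀`, to a `ℂ`-linear map
`ℂ^{S⁺} → W`. It is `ℂ`-linear because the characters of `W` turn it into the coordinates `g s₀`,
and the hypothesis `hs₀` says that `i` acts in the same way on both. -/
theorem IsCMPair.exists_projection (hS : IsCMPair K S Sp) [IsGalois ℚ K] [Fintype S] [Fintype Sp]
    [FiniteDimensional ℚ F] (hm : IsBaseChange ℝ (orbitMap θ m)) {ρ : F →ₐ[ℚ] K} {s₀ : S}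
    {f : equivariantMaps K S →ₐ[ℚ] F} (hf : ∀ e, ρ (f e) = (e : S → K) s₀)
    (hs₀ : ∀ g : Gal(K/ℚ),
      g • s₀ ∈ Sp ↔ character hm (embed ρ g) (Complex.I • m) = Complex.I) :
    ∃ p : (Sp → ℂ) →ₗ[ℂ] W, (∀ e, p (evalRat K S Sp e) = orbitMap θ m (f e)) ∧
      ∀ v, p v = 0 ↔ ∀ s : Sp, (s : S) ∈ MulAction.orbit Gal(K/ℚ) s₀ → v s = 0 := by
  let p : (Sp → ℂ) →ₗ[ℝ] W := hS.isBaseChange.lift (orbitMap θ m ∘ₗ f.toLinearMap)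
  have hp : ∀ e, p (evalRat K S Sp e) = orbitMap θ m (f e) := fun e => hS.isBaseChange.lift_eq _ e
  have hpe : ∀ g e, character hm (embed ρ g) (p (evalRat K S Sp e)) =
      ((e : S → K) (g • s₀) : ℂ) := fun g e => by
    rw [hp, orbitMap_apply, character_orbitMap, embed_apply, hf, equivariantMaps_smul]
  have hpos : ∀ (g : Gal(K/ℚ)) (hg : g • s₀ ∈ Sp) (v : Sp → ℂ),
      character hm (embed ρ g) (p v) = v ⟨g • s₀, hg⟩ := fun g hg v => by
    have h : character hm (embed ρ g) ∘ₗ p = LinearMap.proj ⟨g • s₀, hg⟩ :=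
      hS.isBaseChange.algHom_ext _ _ fun e => hpe g e
    exact LinearMap.congr_fun h v
  have hneg : ∀ (g : Gal(K/ℚ)) (s : Sp), g • s₀ = conjGal K • (s : S) → ∀ v : Sp → ℂ,
      character hm (embed ρ g) (p v) = (starRingEnd ℂ) (v s) := fun g s hg v => by
    have h : character hm (embed ρ g) ∘ₗ p = Complex.conjAe.toLinearMap ∘ₗ LinearMap.proj s :=
      hS.isBaseChange.algHom_ext _ _ fun e => (hpe g e).trans (by
        rw [hg, equivariantMaps_conj_smul]; rfl)
    exact LinearMap.congr_fun h v
  have hzero : ∀ w : W, (∀ g, character hm (embed ρ g) w = 0) → w = 0 := fun w hw =>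
    eq_zero_of_forall_character_eq_zero hm w fun σ => by
      obtain ⟨g, rfl⟩ := exists_eq_embed ρ σ
      exact hw g
  have hI : ∀ v, p (Complex.I • v) = Complex.I • p v := by
    intro v
    rw [← sub_eq_zero]
    refine hzero _ fun g => ?_
    rw [map_sub, character_I_smul, sub_eq_zero]
    by_cases hg : g • s₀ ∈ Sp
    · rw [hpos g hg, hpos g hg, (hs₀ g).1 hg]
      rfl
    · obtain ⟨t, ht, hgt⟩ := (hS.mem_or (g • s₀)).resolve_left hg
      rw [hneg g ⟨t, ht⟩ hgt.symm, hneg g ⟨t, ht⟩ hgt.symm,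
        (character_I_smul_eq_or hm (embed ρ g)).resolve_left (fun h => hg ((hs₀ g).2 h))]
      simp
  let pC : (Sp → ℂ) →ₗ[ℂ] W :=
    { toFun := p
      map_add' := p.map_add
      map_smul' := fun c v => by
        have h1 : c • v = c.re • v + c.im • (Complex.I • v) := by
          ext s
          simp only [Pi.smul_apply, Pi.add_apply, smul_eq_mul, Complex.real_smul]
          nth_rewrite 1 [← Complex.re_add_im c]
          ring
        have h2 : ∀ w : W, c • w = c.re • w + c.im • (Complex.I • w) := fun w => by
          nth_rewrite 1 [← Complex.re_add_im c]
          rw [add_smul, mul_smul]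
          rfl
        rw [h1, map_add, map_smul, map_smul, hI, RingHom.id_apply, h2] }
  refine ⟨pC, hp, fun v => ⟨fun hv s hs => ?_, fun hv => hzero _ fun g => ?_⟩⟩
  · obtain ⟨g, hg⟩ := hs
    have hg' : g • s₀ = s := hg
    have hv' : p v = 0 := hv
    have h1 := hpos g (hg' ▸ s.2) v
    rw [hv', map_zero] at h1
    rw [h1]
    congr 1
    exact Subtype.ext hg'.symm
  · change character hm (embed ρ g) (p v) = 0
    by_cases hg : g • s₀ ∈ Sp
    · rw [hpos g hg, hv _ ⟨g, rfl⟩]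
    · obtain ⟨t, ht, hgt⟩ := (hS.mem_or (g • s₀)).resolve_left hg
      rw [hneg g ⟨t, ht⟩ hgt.symm, hv ⟨t, ht⟩, map_zero]
      change t ∈ MulAction.orbit Gal(K/ℚ) s₀
      rw [← MulAction.orbit_eq_iff, ← MulAction.orbit_smul (conjGal K) t, hgt,
        MulAction.orbit_smul]

theorem mem_span_rat_prod_iff {A B : Type*} [AddCommGroup A] [Module ℚ A] [AddCommGroup B]
    [Module ℚ B] (M : Submodule ℤ A) (N : Submodule ℤ B) (x : A × B) :
    x ∈ Submodule.span ℚ (M.prod N : Set (A × B)) ↔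
      x.1 ∈ Submodule.span ℚ (M : Set A) ∧ x.2 ∈ Submodule.span ℚ (N : Set B) := by
  rw [mem_span_rat_iff, mem_span_rat_iff, mem_span_rat_iff]
  constructor
  · rintro ⟨n, hn, h⟩
    exact ⟨⟨n, hn, h.1⟩, ⟨n, hn, h.2⟩⟩
  · rintro ⟨⟨n, hn, h⟩, ⟨k, hk, h'⟩⟩
    refine ⟨n * k, mul_ne_zero hn hk, ?_, ?_⟩
    · change (n * k) • x.1 ∈ M
      rw [mul_comm, mul_smul]
      exact M.smul_mem _ h
    · change (n * k) • x.2 ∈ N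
      rw [mul_smul]
      exact N.smul_mem _ h'

/-- A simple abelian variety with multiplication by `F` whose CM-type is that of an orbit of `S` is
an isogeny factor of the torus of the pair. The complement is the kernel of the projection: it
consists of the vectors that vanish on the orbit, and multiplication by the idempotent
`orbitIndicator` of `E` splits it off. -/
theorem IsCMPair.isIsogenyFactor (hS : IsCMPair K S Sp) [IsGalois ℚ K] [Fintype S] [Fintype Sp]
    [FiniteDimensional ℂ W] [FiniteDimensional ℚ F] (hm : IsBaseChange ℝ (orbitMap θ m))
    {ρ : F →ₐ[ℚ] K} {s₀ : S}
    (hfix : ∀ g : Gal(K/ℚ), (∀ x, g (ρ x) = ρ x) → g • s₀ = s₀)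
    (hs₀ : ∀ g : Gal(K/ℚ),
      g • s₀ ∈ Sp ↔ character hm (embed ρ g) (Complex.I • m) = Complex.I)
    {M : Submodule ℤ W} (hM : IsAbelianVariety M) (hs : IsSimple M)
    (hrange : LinearMap.range (orbitMap θ m) = Submodule.span ℚ (M : Set W))
    {Λ : Submodule ℤ (equivariantMaps K S)} (hΛ : IsLattice K S Λ) :
    IsIsogenyFactor M (periods K S Sp Λ) := by
  obtain ⟨f, hf⟩ := exists_valueHom hfix
  obtain ⟨p, hp, hker⟩ := hS.exists_projection hm hf hs₀
  have hspan := span_periods (Sp := Sp) hΛ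
  have hA := hS.isAbelianVariety hΛ
  -- The projection is surjective, over `ℂ` by simplicity, and then also over `ℚ`.
  have hpsurj : Function.Surjective p := by
    rw [← LinearMap.range_eq_top]
    refine (hs.range_eq (L := periods K S Sp Λ) hA.span_eq_top p fun v hv => ?_).resolve_left
      fun h0 => ?_
    · obtain ⟨e, -, rfl⟩ := hv
      rw [← hrange]
      exact ⟨f e, (hp e).symm⟩
    · have h1 := character_orbitMap hm (embed ρ 1) (f 1)
      rw [← orbitMap_apply, ← hp, h0, LinearMap.zero_apply, map_zero, map_one, map_one] at h1
      exact zero_ne_one h1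
  have hfsurj : Function.Surjective f := by
    by_contra hns
    have hlt : LinearMap.range f.toLinearMap < ⊤ :=
      lt_top_iff_ne_top.2 fun h => hns (LinearMap.range_eq_top.1 h)
    obtain ⟨φ, hφ, hle⟩ := Submodule.exists_le_ker_of_lt_top _ hlt
    let φ' : W →ₗ[ℝ] ℝ := hm.lift (Algebra.linearMap ℚ ℝ ∘ₗ φ)
    have hφ' : ∀ x, φ' (orbitMap θ m x) = (φ x : ℝ) := fun x => hm.lift_eq _ x
    have h0 : φ' ∘ₗ p.restrictScalars ℝ = 0 := hS.isBaseChange.algHom_ext _ _ fun e => by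
      have h1 : φ (f e) = 0 := hle ⟨e, rfl⟩
      change φ' (p (evalRat K S Sp e)) = 0
      rw [hp, hφ', h1, Rat.cast_zero]
    refine hφ (LinearMap.ext fun x => ?_)
    obtain ⟨v, hv⟩ := hpsurj (orbitMap θ m x)
    have h1 : φ' (p v) = 0 := LinearMap.congr_fun h0 v
    rw [hv, hφ'] at h1
    exact_mod_cast h1
  let U := LinearMap.ker p
  let ε : equivariantMaps K S := orbitIndicator K s₀
  let ι : (Sp → ℂ) →ₗ[ℂ] (Sp → ℂ) := LinearMap.mulLeft ℂ (evalRat K S Sp ε)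
  have hι : ∀ e, ι (evalRat K S Sp e) = evalRat K S Sp (ε * e) := fun e => by
    funext s
    simp [ι, evalRat_apply]
  have hιU : ∀ v, p v = 0 ↔ ι v = 0 := by
    intro v
    rw [hker, funext_iff]
    refine forall_congr' fun s => ?_
    by_cases h : (s : S) ∈ MulAction.orbit Gal(K/ℚ) s₀ <;>
      simp [ι, ε, evalRat_apply, orbitIndicator, h]
  have hιι : ∀ v, ι (ι v) = ι v := fun v => by
    funext s
    by_cases h : (s : S) ∈ MulAction.orbit Gal(K/ℚ) s₀ <;>
      simp [ι, ε, evalRat_apply, orbitIndicator, h]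
  have hcompl : ∀ v, v - ι v ∈ U := fun v => by
    rw [LinearMap.mem_ker, hιU, map_sub, hιι, sub_self]
  have hpι : ∀ v, p (ι v) = p v := fun v => (sub_eq_zero.1 (by
    rw [← map_sub]; exact hcompl v)).symm
  let N : Submodule ℤ U := (periods K S Sp Λ).comap (U.subtype.restrictScalars ℤ)
  have hN : ∀ u : U, u ∈ Submodule.span ℚ (N : Set U) ↔
      (u : Sp → ℂ) ∈ LinearMap.range (evalRat K S Sp) := fun u => by
    rw [← hspan, mem_span_rat_iff, mem_span_rat_iff]
    rfl
  have hUspan : ∀ u ∈ U, u ∈ Submodule.span ℝ ((U : Set (Sp → ℂ)) ∩ (periods K S Sp Λ)) := by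
    have h1 : ∀ v, v - ι v ∈ Submodule.span ℝ ((U : Set (Sp → ℂ)) ∩ (periods K S Sp Λ)) := by
      intro v
      have hv : v ∈ Submodule.span ℝ (periods K S Sp Λ : Set (Sp → ℂ)) := by
        rw [hS.span_real_periods hΛ]; trivial
      induction hv using Submodule.span_induction with
      | mem x hx =>
        obtain ⟨e, -, rfl⟩ := hx
        refine mem_span_real_inter U (hcompl _) ?_
        rw [hspan]
        exact ⟨e - ε * e, by rw [map_sub, ← hι]; rfl⟩
      | zero => simp
      | add x y _ _ hx hy =>
        rw [map_add, add_sub_add_comm]; exact Submodule.add_mem _ hx hy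
      | smul r x _ hx =>
        have : ι (r • x) = r • ι x := (ι.restrictScalars ℝ).map_smul r x
        rw [this, ← smul_sub]
        exact Submodule.smul_mem _ _ hx
    intro u hu
    have h2 := h1 u
    rwa [(hιU u).1 hu, sub_zero] at h2
  have hNA : IsAbelianVariety N := hA.comap_subtype U hUspan
  let q : (Sp → ℂ) →ₗ[ℂ] U := (LinearMap.id - ι).codRestrict U hcompl
  have hq : ∀ v, (q v : Sp → ℂ) = v - ι v := fun v => rfl
  let T : (Sp → ℂ) ≃ₗ[ℂ] W × U := LinearEquiv.ofBijective (p.prod q) ⟨by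
    rw [injective_iff_map_eq_zero]
    intro v hv
    have h1 : p v = 0 := congrArg Prod.fst hv
    have h2 : v - ι v = 0 := congrArg Subtype.val (congrArg Prod.snd hv)
    rwa [(hιU v).1 h1, sub_zero] at h2, by
    rintro ⟨w, u⟩
    obtain ⟨v, rfl⟩ := hpsurj w
    have hu : p u = 0 := u.2
    refine ⟨ι v + u, Prod.ext ?_ (Subtype.ext ?_)⟩
    · change p (ι v + u) = p v
      rw [map_add, hpι, hu, add_zero]
    · change ι v + u - ι (ι v + u) = u
      rw [map_add, hιι, (hιU u).1 hu, add_zero, add_sub_cancel_left]⟩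
  refine ⟨U, inferInstance, inferInstance, inferInstance, N, hNA,
    isogenous_of_linear hA.fg (Submodule.FG.prod hM.fg hNA.fg) T fun v => ?_⟩
  rw [mem_span_rat_prod_iff, hspan, ← hrange, hN]
  change p v ∈ _ ∧ v - ι v ∈ _ ↔ _
  constructor
  · rintro ⟨⟨x, hx⟩, h2⟩
    obtain ⟨e, rfl⟩ := hfsurj x
    have h3 : ι v = ι (evalRat K S Sp e) := by
      rw [← sub_eq_zero, ← map_sub, ← hιU, map_sub, hp, hx, sub_self]
    rw [h3, hι] at h2
    have h4 := Submodule.add_mem _ h2 (LinearMap.mem_range_self (evalRat K S Sp) (ε * e))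
    rwa [sub_add_cancel] at h4
  · rintro ⟨e, rfl⟩
    exact ⟨⟨f e, (hp e).symm⟩, ⟨e - ε * e, by rw [map_sub, ← hι]⟩⟩

/-- The CM-type on `K` induced from a field `F` acting on `W` by an embedding `ρ : F → K`: those `g`
for which `g ρ` occurs in the action of `F` on `W`, or, in other words, for which the form
`character hm (embed ρ g)` is `ℂ`-linear. -/
def inducedCMType (hm : IsBaseChange ℝ (orbitMap θ m)) (ρ : F →ₐ[ℚ] K) : CMType K :=
  ⟨{g | character hm (embed ρ g) (Complex.I • m) = Complex.I}, by
    have hconj : ∀ g, character hm (embed ρ (conjGal K * g)) (Complex.I • m) =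
        (starRingEnd ℂ) (character hm (embed ρ g) (Complex.I • m)) := fun g =>
      character_conj hm _ _ (fun x => apply_conjGal K.subtype (g (ρ x))) _
    have hne : (-Complex.I) ≠ Complex.I := fun h => Complex.I_ne_zero (self_eq_neg.1 h.symm)
    refine ⟨Set.disjoint_left.2 ?_, Set.eq_univ_of_forall fun g => ?_⟩
    · rintro _ hg ⟨h, hh, rfl⟩
      have hg' : character hm (embed ρ (conjGal K * h)) (Complex.I • m) = Complex.I := hg
      have hh' : character hm (embed ρ h) (Complex.I • m) = Complex.I := hh
      rw [hconj, hh', Complex.conj_I] at hg'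
      exact hne hg'
    · rcases character_I_smul_eq_or hm (embed ρ g) with h | h
      · exact Or.inl h
      · refine Or.inr ⟨conjGal K * g, ?_, ?_⟩
        · change character hm (embed ρ (conjGal K * g)) (Complex.I • m) = Complex.I
          rw [hconj, h, map_neg, Complex.conj_I, neg_neg]
        · change conjGal K * (conjGal K * g) = g
          rw [← mul_assoc, conjGal_mul_self, one_mul]⟩

theorem smul_inducedCMType (hm : IsBaseChange ℝ (orbitMap θ m)) (ρ : F →ₐ[ℚ] K) (g : Gal(K/ℚ))
    (hg : ∀ x, g (ρ x) = ρ x) : g • inducedCMType hm ρ = inducedCMType hm ρ := by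
  refine Subtype.ext (Set.ext fun h => ?_)
  rw [CMType.mem_smul_iff]
  have h1 : embed ρ (h * g) = embed ρ h := AlgHom.ext fun x => by
    rw [embed_apply, embed_apply, AlgEquiv.mul_apply, hg]
  change character hm (embed ρ (h * g)) _ = _ ↔ character hm (embed ρ h) _ = _
  rw [h1]

end Factor

end

open ComplexTorus in
theorem mainTheorem4 (K : Subfield ℂ) [NumberField K] [NumberField.IsCMField K] [IsGalois ℚ K] :
    IsCMPair K (CMType K) (CMType.plus K) ∧
    (∃ Λ : Submodule ℤ (equivariantMaps K (CMType K)), IsLattice K (CMType K) Λ) ∧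
    (∀ Λ Λ' : Submodule ℤ (equivariantMaps K (CMType K)),
      IsLattice K (CMType K) Λ → IsLattice K (CMType K) Λ' →
      Isogenous (periods K (CMType K) (CMType.plus K) Λ)
        (periods K (CMType K) (CMType.plus K) Λ')) ∧
    (∀ Λ : Submodule ℤ (equivariantMaps K (CMType K)), IsLattice K (CMType K) Λ →
      IsAbelianVariety (periods K (CMType K) (CMType.plus K) Λ) ∧
      IsCM (periods K (CMType K) (CMType.plus K) Λ) ∧
      IsSplitBy K (periods K (CMType K) (CMType.plus K) Λ) ∧
      ∀ (W : Type u) [NormedAddCommGroup W] [NormedSpace ℂ W] [FiniteDimensional ℂ W]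
        (M : Submodule ℤ W),
        IsAbelianVariety M → IsSimple M → IsCM M → IsSplitBy K M →
        IsIsogenyFactor M (periods K (CMType K) (CMType.plus K) Λ)) := by
  have : Fintype (CMType K) := Fintype.ofFinite _
  have hS := isCMPair_cmType (K := K)
  have hsep := CMType.eq_of_forall_smul_mem_plus (K := K)
  refine ⟨hS, exists_isLattice K _, fun Λ Λ' hΛ hΛ' => isogenous_periods hΛ hΛ', fun Λ hΛ =>
    ⟨hS.isAbelianVariety hΛ, hS.isCM hsep hΛ, hS.isSplitBy hsep hΛ, ?_⟩⟩
  intro W _ _ _ M hM hs hcm hK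
  let _ : Module ℚ W := Module.compHom W (algebraMap ℚ ℂ)
  obtain ⟨F, _, _, _, θ, m, hm, hrange, ⟨ρ⟩⟩ := hs.exists_field hM hcm K hK
  exact hS.isIsogenyFactor hm (smul_inducedCMType hm ρ)
    (CMType.smul_mem_plus_iff (inducedCMType hm ρ)) hM hs hrange hΛ
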